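/- For a finite set $H\subseteq\mathbb{N}$ let the gap size $gs(H)$ be the largest difference between two consecutive elements of $H$, with $gs(H)=1$ if $|H|\le 1$. Identify a natural number $n$ with $\{0,\dots,n-1\}$; for a colouring $C\colon n\to r$, a set $H\subseteq n$ is $C$-homogeneous if $C$ is constant on $H$. The finite version of Brown's lemma is the statement: for every $f\colon\mathbb{N}\to\mathbb{N}$ and every $r>0$ there exists $n$ such that every colouring $C\colon n\to r$ has a $C$-homogeneous set $H$ with $|H|>f(gs(H))$. Theorem. The finite version of Brown's lemma holds; moreover, expressed as a sentence of the language of second-order arithmetic, it is provable in $\mathsf{RCA}_0$, the system consisting of the basic axioms for $0,1,+,\cdot,<$, the scheme of $\Sigma^0_1$-induction and the scheme of $\Delta^0_1$-comprehension (both with number and set parameters). -/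

import Mathlib

/-! ### The gap size of a finite set and the finite form of Brown's lemma -/

/-- The gap size of a finite set `H` of natural numbers: the largest difference between two
consecutive elements of `H`, and `1` if `H` has at most one element. -/
def gapSize (H : Finset ℕ) : ℕ :=
  if H.card ≤ 1 then 1
  else ((H ×ˢ H).filter (fun p => p.1 < p.2 ∧ ∀ z ∈ H, ¬(p.1 < z ∧ z < p.2))).sup
    (fun p => p.2 - p.1)

/-- The finite form of Brown's lemma, as a statement about the actual natural numbers. -/
def FiniteBrownLemma : Prop :=
  ∀ f : ℕ → ℕ, ∀ r : ℕ, 0 < r → ∃ n : ℕ, ∀ C : Fin n → Fin r,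
    ∃ H : Finset (Fin n), (∃ c : Fin r, ∀ x ∈ H, C x = c) ∧
      f (gapSize (H.map Fin.valEmbedding)) < H.card

namespace SOA

/-! ### The two-sorted language of second-order arithmetic

Bound variables are de Bruijn indices. Number variables and set variables are indexed
separately: a number quantifier binds number variable `0`, a set quantifier set variable `0`. -/

/-- Number terms. -/
inductive Tm : Type
  | var : ℕ → Tm
  | zero : Tm
  | one : Tm
  | add : Tm → Tm → Tm
  | mul : Tm → Tm → Tm

/-- Formulas. The only set terms are set variables, here represented by their indices. -/
inductive Fml : Type
  | bot : Fml
  | eq : Tm → Tm → Fml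
  | lt : Tm → Tm → Fml
  | mem : Tm → ℕ → Fml
  | imp : Fml → Fml → Fml
  | all : Fml → Fml
  | allS : Fml → Fml

namespace Tm

/-- Simultaneous substitution of terms for number variables. -/
def subst (σ : ℕ → Tm) : Tm → Tm
  | var n => σ n
  | zero => zero
  | one => one
  | add s t => add (subst σ s) (subst σ t)
  | mul s t => mul (subst σ s) (subst σ t)

/-- Weakening by one number variable. -/
def shift (t : Tm) : Tm := t.subst (fun n => var (n + 1))

/-- The pairing function `(i, j) = (i + j)² + i`. -/
def pair (i j : Tm) : Tm := add (mul (add i j) (add i j)) i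

end Tm

/-- A substitution moved under a number quantifier. -/
def up (σ : ℕ → Tm) : ℕ → Tm
  | 0 => Tm.var 0
  | n + 1 => (σ n).shift

/-- A renaming of set variables moved under a set quantifier. -/
def upS (ρ : ℕ → ℕ) : ℕ → ℕ
  | 0 => 0
  | n + 1 => ρ n + 1

namespace Fml

/-- Simultaneous capture-avoiding substitution of terms for number variables and of set
variables for set variables. -/
def subst : (ℕ → Tm) → (ℕ → ℕ) → Fml → Fml
  | _, _, bot => bot
  | σ, _, eq s t => eq (s.subst σ) (t.subst σ)
  | σ, _, lt s t => lt (s.subst σ) (t.subst σ)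
  | σ, ρ, mem t X => mem (t.subst σ) (ρ X)
  | σ, ρ, imp φ ψ => imp (subst σ ρ φ) (subst σ ρ ψ)
  | σ, ρ, all φ => all (subst (up σ) ρ φ)
  | σ, ρ, allS φ => allS (subst σ (upS ρ) φ)

/-- Weakening by one number variable. -/
def shift (φ : Fml) : Fml := φ.subst (fun n => Tm.var (n + 1)) id

/-- Weakening by one set variable. -/
def shiftS (φ : Fml) : Fml := φ.subst Tm.var Nat.succ

/-- `φ(t)`: number variable `0` is replaced by `t` and removed. -/
def inst (φ : Fml) (t : Tm) : Fml :=
  φ.subst (fun n => match n with | 0 => t | k + 1 => Tm.var k) id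

/-- `φ(Y)`: set variable `0` is replaced by `Y` and removed. -/
def instS (φ : Fml) (Y : ℕ) : Fml :=
  φ.subst Tm.var (fun n => match n with | 0 => Y | k + 1 => k)

/-- `φ(x + 1)`, where `x` is number variable `0`. -/
def succ (φ : Fml) : Fml :=
  φ.subst (fun n => match n with
    | 0 => Tm.add (Tm.var 0) Tm.one
    | k + 1 => Tm.var (k + 1)) id

def neg (φ : Fml) : Fml := imp φ bot
def or (φ ψ : Fml) : Fml := imp (neg φ) ψ
def and (φ ψ : Fml) : Fml := neg (imp φ (neg ψ))
def iff (φ ψ : Fml) : Fml := and (imp φ ψ) (imp ψ φ)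
def ex (φ : Fml) : Fml := neg (all (neg φ))
def exS (φ : Fml) : Fml := neg (allS (neg φ))

/-- There is exactly one number `x` with `φ(x)`. -/
def exUnique (φ : Fml) : Fml :=
  ex (and φ (all (imp
    (φ.subst (fun n => match n with | 0 => Tm.var 0 | k + 1 => Tm.var (k + 2)) id)
    (eq (Tm.var 0) (Tm.var 1)))))

end Fml

/-! ### Derivability in classical two-sorted first-order logic with equality -/

/-- `Deriv T Γ φ`: there is a natural-deduction derivation of `φ` from the axioms `T` and the
open assumptions `Γ`. Free variables of axioms are read as universally quantified, so axioms,
unlike assumptions, are not affected by the eigenvariable conditions. -/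
inductive Deriv (T : Set Fml) : List Fml → Fml → Prop
  | ax {Γ : List Fml} {φ : Fml} : φ ∈ T → Deriv T Γ φ
  | hyp {Γ : List Fml} {φ : Fml} : φ ∈ Γ → Deriv T Γ φ
  | impI {Γ : List Fml} {φ ψ : Fml} : Deriv T (φ :: Γ) ψ → Deriv T Γ (φ.imp ψ)
  | impE {Γ : List Fml} {φ ψ : Fml} : Deriv T Γ (φ.imp ψ) → Deriv T Γ φ → Deriv T Γ ψ
  | raa {Γ : List Fml} {φ : Fml} : Deriv T (φ.neg :: Γ) Fml.bot → Deriv T Γ φ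
  | allI {Γ : List Fml} {φ : Fml} : Deriv T (Γ.map Fml.shift) φ → Deriv T Γ φ.all
  | allE {Γ : List Fml} {φ : Fml} (t : Tm) : Deriv T Γ φ.all → Deriv T Γ (φ.inst t)
  | allSI {Γ : List Fml} {φ : Fml} : Deriv T (Γ.map Fml.shiftS) φ → Deriv T Γ φ.allS
  | allSE {Γ : List Fml} {φ : Fml} (Y : ℕ) : Deriv T Γ φ.allS → Deriv T Γ (φ.instS Y)
  | eqRefl {Γ : List Fml} (t : Tm) : Deriv T Γ (Fml.eq t t)
  | eqSubst {Γ : List Fml} (φ : Fml) {s t : Tm} :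
      Deriv T Γ (Fml.eq s t) → Deriv T Γ (φ.inst s) → Deriv T Γ (φ.inst t)

/-- Provability of `φ` in the theory with axioms `T`. -/
def Provable (T : Set Fml) (φ : Fml) : Prop := Deriv T [] φ

/-! ### The system RCA₀ -/

/-- The `Σ⁰₀` formulas: all quantifiers are bounded number quantifiers `∀ x < t`, `∃ x < t`,
where `x` does not occur in `t`; set variables may occur free. -/
inductive IsSigma00 : Fml → Prop
  | bot : IsSigma00 Fml.bot
  | eq (s t : Tm) : IsSigma00 (Fml.eq s t)
  | lt (s t : Tm) : IsSigma00 (Fml.lt s t)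
  | mem (t : Tm) (X : ℕ) : IsSigma00 (Fml.mem t X)
  | imp {φ ψ : Fml} : IsSigma00 φ → IsSigma00 ψ → IsSigma00 (φ.imp ψ)
  | ball (t : Tm) {φ : Fml} :
      IsSigma00 φ → IsSigma00 (Fml.all (Fml.imp (Fml.lt (Tm.var 0) t.shift) φ))
  | bex (t : Tm) {φ : Fml} :
      IsSigma00 φ → IsSigma00 (Fml.ex (Fml.and (Fml.lt (Tm.var 0) t.shift) φ))

def IsSigma01 (φ : Fml) : Prop := ∃ θ : Fml, IsSigma00 θ ∧ φ = θ.ex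

def IsPi01 (φ : Fml) : Prop := ∃ θ : Fml, IsSigma00 θ ∧ φ = θ.all

open Tm Fml in
/-- The basic axioms, with free number variables `m` (index `0`) and `n` (index `1`). -/
def basicAxioms : Set Fml :=
  { neg (eq (add (var 0) one) zero),
    imp (eq (add (var 0) one) (add (var 1) one)) (eq (var 0) (var 1)),
    eq (add (var 0) zero) (var 0),
    eq (add (var 0) (add (var 1) one)) (add (add (var 0) (var 1)) one),
    eq (mul (var 0) zero) zero,
    eq (mul (var 0) (add (var 1) one)) (add (mul (var 0) (var 1)) (var 0)),
    neg (lt (var 0) zero),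
    iff (lt (var 0) (add (var 1) one)) (or (lt (var 0) (var 1)) (eq (var 0) (var 1))) }

open Tm Fml in
/-- `(φ(0) ∧ ∀ x (φ(x) → φ(x + 1))) → ∀ x φ(x)`; all other variables of `φ` are parameters. -/
def induction (φ : Fml) : Fml :=
  imp (and (φ.inst zero) (all (imp φ φ.succ))) (all φ)

open Tm Fml in
/-- `∀ x (φ(x) ↔ ψ(x)) → ∃ X ∀ x (x ∈ X ↔ φ(x))`, with `X` not free in `φ`. -/
def comprehension (φ ψ : Fml) : Fml :=
  imp (all (iff φ ψ)) (exS (all (iff (mem (var 0) 0) φ.shiftS)))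

/-- The axioms of RCA₀: the basic axioms, `Σ⁰₁` induction and `Δ⁰₁` comprehension. -/
def RCA0 : Set Fml :=
  basicAxioms ∪ {χ | ∃ φ, IsSigma01 φ ∧ χ = induction φ} ∪
    {χ | ∃ φ ψ, IsSigma01 φ ∧ IsPi01 ψ ∧ χ = comprehension φ ψ}

/-! ### The finite form of Brown's lemma as a sentence of second-order arithmetic

Functions are sets of pairs. In the definitions below the arguments of type `ℕ` are set
variables, and term arguments are shifted when they pass under a number quantifier. -/

section Sentence
open Tm Fml

/-- `F` is a function from `ℕ` to `ℕ`. -/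
def isFunction (F : ℕ) : Fml :=
  and
    -- every element of `F` is a pair
    (all (imp (mem (var 0) F) (ex (ex (eq (var 2) (pair (var 1) (var 0)))))))
    -- every `x` has exactly one value
    (all (exUnique (mem (pair (var 1) (var 0)) F)))

/-- `C` is a function from `{x | x < n}` to `{y | y < r}`. -/
def isColoring (C : ℕ) (n r : Tm) : Fml :=
  and
    -- every element of `C` is a pair `(x, y)` with `x < n` and `y < r`
    (all (imp (mem (var 0) C) (ex (ex (and (eq (var 2) (pair (var 1) (var 0)))
      (and (lt (var 1) n.shift.shift.shift) (lt (var 0) r.shift.shift.shift)))))))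
    -- every `x < n` has exactly one value
    (all (imp (lt (var 0) n.shift) (exUnique (mem (pair (var 1) (var 0)) C))))

/-- `G` is a bijection from `{i | i < k}` onto `H`. -/
def isEnumeration (G H : ℕ) (k : Tm) : Fml :=
  and
    -- every element of `G` is a pair `(i, x)` with `i < k` and `x ∈ H`
    (all (imp (mem (var 0) G) (ex (ex (and (eq (var 2) (pair (var 1) (var 0)))
      (and (lt (var 1) k.shift.shift.shift) (mem (var 0) H)))))))
    (and
      -- every `i < k` has exactly one value
      (all (imp (lt (var 0) k.shift) (exUnique (mem (pair (var 1) (var 0)) G))))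
      -- every `x ∈ H` is the value of exactly one `i`
      (all (imp (mem (var 0) H) (exUnique (mem (pair (var 0) (var 1)) G)))))

/-- `|H| = k`. -/
def hasCard (H : ℕ) (k : Tm) : Fml := exS (isEnumeration 0 (H + 1) k)

/-- `x < y` are consecutive elements of `H`. -/
def consecutive (H : ℕ) (x y : Tm) : Fml :=
  and (mem x H) (and (mem y H) (and (lt x y)
    (all (imp (mem (var 0) H) (neg (and (lt x.shift (var 0)) (lt (var 0) y.shift)))))))

/-- `H` has at most one element. -/
def atMostOne (H : ℕ) : Fml :=
  all (all (imp (and (mem (var 1) H) (mem (var 0) H)) (eq (var 1) (var 0))))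

/-- `gs(H) = d`. -/
def hasGapSize (H : ℕ) (d : Tm) : Fml :=
  or (and (atMostOne H) (eq d one))
    (and (neg (atMostOne H)) (and
      -- `d` is a difference of consecutive elements `x < y`
      (ex (ex (and (consecutive H (var 1) (var 0))
        (eq (var 0) (add (var 1) d.shift.shift)))))
      -- every such difference is at most `d`
      (all (all (imp (consecutive H (var 1) (var 0))
        (neg (lt (add (var 1) d.shift.shift) (var 0))))))))

/-- `H` is a `C`-homogeneous subset of `{x | x < n}`. -/
def isHomogeneous (H C : ℕ) (n : Tm) : Fml :=
  and (all (imp (mem (var 0) H) (lt (var 0) n.shift)))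
    (ex (all (imp (mem (var 0) H) (mem (pair (var 0) (var 1)) C))))

/-- `|H| > f(gs(H))`: there are `k`, `d`, `m` with `|H| = k`, `gs(H) = d`, `f(d) = m`, `m < k`. -/
def isLarge (H f : ℕ) : Fml :=
  ex (ex (ex (and (hasCard H (var 2)) (and (hasGapSize H (var 1))
    (and (mem (pair (var 1) (var 0)) f) (lt (var 0) (var 2)))))))

/-- For every `f : ℕ → ℕ` and every `r > 0` there is `n` such that for every `C : n → r` there is
a `C`-homogeneous set `H` with `|H| > f(gs(H))`. -/
def finiteBrown : Fml :=
  -- `f` is set variable `0`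
  allS (imp (isFunction 0)
    -- `r` is number variable `0`, then `n` is `0` and `r` is `1`
    (all (imp (lt zero (var 0)) (ex
      -- `C` is set variable `0` and `f` is `1`
      (allS (imp (isColoring 0 (var 0) (var 1))
        -- `H` is set variable `0`, `C` is `1` and `f` is `2`
        (exS (and (isHomogeneous 0 1 (var 0)) (isLarge 0 2)))))))))

end Sentence

end SOA

/-! The combinatorics is one recursion. Put `n₀ = 1` and `n_{k+1} = n_k (B + 1)`, where `B` bounds
`f` on `[0, 2 n_k]`. Suppose an interval of length `n_{k+1}` is coloured with colours below `k + 1`,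
and split it into `B + 1` blocks of length `n_k`. If colour `k` occurs in every block, choosing one
point of that colour per block gives `B + 1` points with gaps at most `2 n_k`, hence more points
than `f` of the gap size. Otherwise some block uses only colours below `k`, and one continues there.
No interval of positive length can be coloured with no colours, so the descent stops with a large
homogeneous set. For the actual natural numbers this is an induction on the number of colours
(`exists_large_homogeneous`).

Provability is obtained semantically. A Henkin construction gives completeness of the deductive
system (`provable_of_models`), so it suffices to verify the sentence in an arbitrary, possibly
nonstandard, model of RCA₀. Two points need care there.

The sequence `n₀, …, n_r` must exist. Finite sets are coded by numbers with Gödel's divisibility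
trick (`exists_code`), so that the existence of a computation of length `k` becomes a `Σ⁰₁`
statement, proved by induction (`exists_chain`).

The statement about all colourings quantifies over sets, so `Σ⁰₁` induction does not apply to it.
Instead the colouring is fixed, and one takes the least `k` for which some interval of length `n_k`
uses only colours below `k` (`exists_large_of_chain`). This condition is `Σ⁰₀`, and minimality
forces the next lower colour into every block.

Definability side conditions are discharged by the type classes `DefTm` and `Def0`, whose instances
mirror the formation rules of `Σ⁰₀` formulas. -/

/-! ### Substitution -/

namespace SOA

/-- The sequence `a, e 0, e 1, …`. -/
def scons {α : Type} (a : α) (e : ℕ → α) : ℕ → α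
  | 0 => a
  | n + 1 => e n

@[simp] theorem scons_zero {α : Type} (a : α) (e : ℕ → α) : scons a e 0 = a := rfl
@[simp] theorem scons_succ {α : Type} (a : α) (e : ℕ → α) (n : ℕ) :
    scons a e (n + 1) = e n := rfl

namespace Tm

theorem subst_subst (σ τ : ℕ → Tm) (t : Tm) :
    (t.subst σ).subst τ = t.subst (fun n => (σ n).subst τ) := by
  induction t <;> simp_all [subst]

theorem subst_var (t : Tm) : t.subst var = t := by
  induction t <;> simp_all [subst]

theorem subst_shift (σ : ℕ → Tm) (t : Tm) :
    t.shift.subst σ = t.subst (fun n => σ (n + 1)) := by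
  simp [shift, subst_subst, subst]

theorem shift_subst_up (σ : ℕ → Tm) (t : Tm) : t.shift.subst (up σ) = (t.subst σ).shift := by
  simp [shift, subst_subst, subst, up]

theorem shift_subst_scons (σ : ℕ → Tm) (s t : Tm) : t.shift.subst (scons s σ) = t.subst σ := by
  rw [subst_shift]; rfl

theorem exists_bound (t : Tm) :
    ∃ k, ∀ σ σ' : ℕ → Tm, (∀ n < k, σ n = σ' n) → t.subst σ = t.subst σ' := by
  induction t with
  | var n => exact ⟨n + 1, fun σ σ' h => h n (Nat.lt_succ_self n)⟩
  | zero => exact ⟨0, fun _ _ _ => rfl⟩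
  | one => exact ⟨0, fun _ _ _ => rfl⟩
  | add s t hs ht =>
    obtain ⟨k, hk⟩ := hs
    obtain ⟨l, hl⟩ := ht
    refine ⟨max k l, fun σ σ' h => ?_⟩
    simp only [subst]
    rw [hk σ σ' fun n hn => h n (by omega), hl σ σ' fun n hn => h n (by omega)]
  | mul s t hs ht =>
    obtain ⟨k, hk⟩ := hs
    obtain ⟨l, hl⟩ := ht
    refine ⟨max k l, fun σ σ' h => ?_⟩
    simp only [subst]
    rw [hk σ σ' fun n hn => h n (by omega), hl σ σ' fun n hn => h n (by omega)]

end Tm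

theorem up_var : up Tm.var = Tm.var := by
  funext n; cases n <;> rfl

theorem upS_id : upS id = id := by
  funext n; cases n <;> rfl

theorem up_subst_up (σ τ : ℕ → Tm) :
    (fun n => (up σ n).subst (up τ)) = up (fun n => (σ n).subst τ) := by
  funext n
  cases n with
  | zero => rfl
  | succ n => exact Tm.shift_subst_up τ (σ n)

theorem up_subst_scons (σ τ : ℕ → Tm) (t : Tm) :
    (fun n => (up σ n).subst (scons t τ)) = scons t (fun n => (σ n).subst τ) := by
  funext n
  cases n with
  | zero => rfl
  | succ n => exact Tm.shift_subst_scons τ t (σ n)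

theorem upS_comp_upS (ρ π : ℕ → ℕ) : upS π ∘ upS ρ = upS (π ∘ ρ) := by
  funext n; cases n <;> rfl

theorem scons_comp_upS {α : Type} (a : α) (π : ℕ → α) (ρ : ℕ → ℕ) :
    scons a π ∘ upS ρ = scons a (π ∘ ρ) := by
  funext n; cases n <;> rfl

namespace Fml

theorem subst_subst (φ : Fml) (σ τ : ℕ → Tm) (ρ π : ℕ → ℕ) :
    (φ.subst σ ρ).subst τ π = φ.subst (fun n => (σ n).subst τ) (π ∘ ρ) := by
  induction φ generalizing σ τ ρ π with
  | bot => rfl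
  | eq s t => simp [subst, Tm.subst_subst]
  | lt s t => simp [subst, Tm.subst_subst]
  | mem t X => simp [subst, Tm.subst_subst]
  | imp φ ψ hφ hψ => simp [subst, hφ, hψ]
  | all φ h => simp [subst, h, up_subst_up]
  | allS φ h => simp [subst, h, upS_comp_upS]

theorem subst_var (φ : Fml) : φ.subst Tm.var id = φ := by
  induction φ with
  | bot => rfl
  | eq s t => simp [subst, Tm.subst_var]
  | lt s t => simp [subst, Tm.subst_var]
  | mem t X => simp [subst, Tm.subst_var]
  | imp φ ψ hφ hψ => simp [subst, hφ, hψ]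
  | all φ h => simp [subst, h, up_var]
  | allS φ h => simp [subst, h, upS_id]

theorem inst_eq (φ : Fml) (t : Tm) : φ.inst t = φ.subst (scons t Tm.var) id := by
  unfold inst; congr 1

theorem instS_eq (φ : Fml) (Y : ℕ) : φ.instS Y = φ.subst Tm.var (scons Y id) := by
  unfold instS; congr 1

theorem succ_eq (φ : Fml) : φ.succ = φ.subst
    (scons (Tm.add (Tm.var 0) Tm.one) (fun n => Tm.var (n + 1))) id := by
  unfold succ; congr 1

theorem subst_up_inst (φ : Fml) (σ : ℕ → Tm) (ρ : ℕ → ℕ) (t : Tm) :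
    (φ.subst (up σ) ρ).inst t = φ.subst (scons t σ) ρ := by
  rw [inst_eq, subst_subst, up_subst_scons]
  simp [Tm.subst_var]

theorem subst_upS_instS (φ : Fml) (σ : ℕ → Tm) (ρ : ℕ → ℕ) (Y : ℕ) :
    (φ.subst σ (upS ρ)).instS Y = φ.subst σ (scons Y ρ) := by
  rw [instS_eq, subst_subst, scons_comp_upS]
  simp [Tm.subst_var]

theorem inst_subst (φ : Fml) (t : Tm) (σ : ℕ → Tm) (ρ : ℕ → ℕ) :
    (φ.inst t).subst σ ρ = (φ.subst (up σ) ρ).inst (t.subst σ) := by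
  rw [subst_up_inst, inst_eq, subst_subst]
  congr 1
  funext n; cases n <;> rfl

theorem instS_subst (φ : Fml) (Y : ℕ) (σ : ℕ → Tm) (ρ : ℕ → ℕ) :
    (φ.instS Y).subst σ ρ = (φ.subst σ (upS ρ)).instS (ρ Y) := by
  rw [subst_upS_instS, instS_eq, subst_subst]
  congr 1
  funext n; cases n <;> rfl

theorem shift_subst_up (φ : Fml) (σ : ℕ → Tm) (ρ : ℕ → ℕ) :
    φ.shift.subst (up σ) ρ = (φ.subst σ ρ).shift := by
  simp only [shift, subst_subst]
  congr 1

theorem shiftS_subst_upS (φ : Fml) (σ : ℕ → Tm) (ρ : ℕ → ℕ) :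
    φ.shiftS.subst σ (upS ρ) = (φ.subst σ ρ).shiftS := by
  simp only [shiftS, subst_subst, Tm.subst_var]
  congr 1

theorem succ_subst_up (φ : Fml) (σ : ℕ → Tm) (ρ : ℕ → ℕ) :
    φ.succ.subst (up σ) ρ = (φ.subst (up σ) ρ).succ := by
  simp only [succ_eq, subst_subst]
  congr 1
  funext n
  cases n with
  | zero => rfl
  | succ n => exact (Tm.shift_subst_scons (fun n => Tm.var (n + 1)) _ (σ n)).symm

/-- Only finitely many variables occur in a formula; stated through substitution, this avoids a
definition of free variables and is what supplies fresh ones. -/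
theorem exists_bound (φ : Fml) : ∃ k, ∀ (σ σ' : ℕ → Tm) (ρ : ℕ → ℕ),
    (∀ n < k, σ n = σ' n) → φ.subst σ ρ = φ.subst σ' ρ := by
  induction φ with
  | bot => exact ⟨0, fun _ _ _ _ => rfl⟩
  | eq s t | lt s t =>
    obtain ⟨k, hk⟩ := s.exists_bound
    obtain ⟨l, hl⟩ := t.exists_bound
    refine ⟨max k l, fun σ σ' ρ h => ?_⟩
    simp only [subst]
    rw [hk σ σ' fun n hn => h n (by omega), hl σ σ' fun n hn => h n (by omega)]
  | mem t X =>
    obtain ⟨k, hk⟩ := t.exists_bound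
    refine ⟨k, fun σ σ' ρ h => ?_⟩
    simp only [subst]
    rw [hk σ σ' h]
  | imp φ ψ hφ hψ =>
    obtain ⟨k, hk⟩ := hφ
    obtain ⟨l, hl⟩ := hψ
    refine ⟨max k l, fun σ σ' ρ h => ?_⟩
    simp only [subst]
    rw [hk σ σ' ρ fun n hn => h n (by omega), hl σ σ' ρ fun n hn => h n (by omega)]
  | all φ h =>
    obtain ⟨k, hk⟩ := h
    refine ⟨k, fun σ σ' ρ h => ?_⟩
    simp only [subst]
    rw [hk (up σ) (up σ') ρ]
    intro n hn
    cases n with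
    | zero => rfl
    | succ n => simp only [up, h n (by omega)]
  | allS φ h =>
    obtain ⟨k, hk⟩ := h
    refine ⟨k, fun σ σ' ρ h => ?_⟩
    simp only [subst]
    rw [hk σ σ' (upS ρ) h]

theorem exists_boundS (φ : Fml) : ∃ k, ∀ (σ : ℕ → Tm) (ρ ρ' : ℕ → ℕ),
    (∀ n < k, ρ n = ρ' n) → φ.subst σ ρ = φ.subst σ ρ' := by
  induction φ with
  | bot => exact ⟨0, fun _ _ _ _ => rfl⟩
  | eq s t | lt s t => exact ⟨0, fun _ _ _ _ => rfl⟩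
  | mem t X =>
    refine ⟨X + 1, fun σ ρ ρ' h => ?_⟩
    simp only [subst]
    rw [h X (Nat.lt_succ_self X)]
  | imp φ ψ hφ hψ =>
    obtain ⟨k, hk⟩ := hφ
    obtain ⟨l, hl⟩ := hψ
    refine ⟨max k l, fun σ ρ ρ' h => ?_⟩
    simp only [subst]
    rw [hk σ ρ ρ' fun n hn => h n (by omega), hl σ ρ ρ' fun n hn => h n (by omega)]
  | all φ h =>
    obtain ⟨k, hk⟩ := h
    refine ⟨k, fun σ ρ ρ' h => ?_⟩
    simp only [subst]
    rw [hk (up σ) ρ ρ' h]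
  | allS φ h =>
    obtain ⟨k, hk⟩ := h
    refine ⟨k, fun σ ρ ρ' h => ?_⟩
    simp only [subst]
    rw [hk σ (upS ρ) (upS ρ')]
    intro n hn
    cases n with
    | zero => rfl
    | succ n => simp only [upS, h n (by omega)]

end Fml

/-! ### Admissible rules -/

namespace Deriv
variable {T : Set Fml} {Γ Δ : List Fml} {φ ψ : Fml}

theorem weaken (h : Deriv T Γ φ) (hΓ : Γ ⊆ Δ) : Deriv T Δ φ := by
  induction h generalizing Δ with
  | ax h => exact .ax h
  | hyp h => exact .hyp (hΓ h)
  | impI _ ih => exact .impI (ih (List.cons_subset_cons _ hΓ))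
  | impE _ _ ih₁ ih₂ => exact .impE (ih₁ hΓ) (ih₂ hΓ)
  | raa _ ih => exact .raa (ih (List.cons_subset_cons _ hΓ))
  | allI _ ih => exact .allI (ih (List.map_subset _ hΓ))
  | allE t _ ih => exact .allE t (ih hΓ)
  | allSI _ ih => exact .allSI (ih (List.map_subset _ hΓ))
  | allSE Y _ ih => exact .allSE Y (ih hΓ)
  | eqRefl t => exact .eqRefl t
  | eqSubst φ _ _ ih₁ ih₂ => exact .eqSubst φ (ih₁ hΓ) (ih₂ hΓ)

/-- `T` derives all substitution instances of its axioms. -/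
def _root_.SOA.SubstClosed (T : Set Fml) : Prop :=
  ∀ φ ∈ T, ∀ σ ρ, Deriv T [] (φ.subst σ ρ)

/-- A substitution can be pushed through a whole derivation; only the axiom leaves need a hypothesis
on `T`. Its purpose is the renaming of a fresh variable to the eigenvariable `0`. -/
theorem subst (hT : SubstClosed T) (h : Deriv T Γ φ) (σ : ℕ → Tm) (ρ : ℕ → ℕ) :
    Deriv T (Γ.map (Fml.subst σ ρ)) (φ.subst σ ρ) := by
  induction h generalizing σ ρ with
  | ax h => exact (hT _ h σ ρ).weaken (List.nil_subset _)
  | hyp h => exact .hyp (List.mem_map_of_mem h)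
  | impI _ ih => exact .impI (ih σ ρ)
  | impE _ _ ih₁ ih₂ => exact .impE (ih₁ σ ρ) (ih₂ σ ρ)
  | raa _ ih => exact .raa (ih σ ρ)
  | @allI Γ φ _ ih =>
    refine .allI ?_
    have := ih (up σ) ρ
    simpa only [List.map_map, Function.comp_def, Fml.shift_subst_up] using this
  | allE t _ ih =>
    rw [Fml.inst_subst]
    exact .allE _ (ih σ ρ)
  | allSI _ ih =>
    refine .allSI ?_
    have := ih σ (upS ρ)
    simpa only [List.map_map, Function.comp_def, Fml.shiftS_subst_upS] using this
  | allSE Y _ ih =>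
    rw [Fml.instS_subst]
    exact .allSE _ (ih σ ρ)
  | eqRefl t => exact .eqRefl _
  | eqSubst φ _ _ ih₁ ih₂ =>
    have h₂ := ih₂ σ ρ
    rw [Fml.inst_subst] at h₂ ⊢
    exact .eqSubst _ (ih₁ σ ρ) h₂

theorem exfalso (h : Deriv T Γ Fml.bot) : Deriv T Γ φ :=
  .raa (h.weaken (List.subset_cons_self _ _))

/-- Generalization over a number variable that is not free in the assumptions. -/
theorem exists_fresh (hT : SubstClosed T) (Γ : List Fml) (φ : Fml) :
    ∃ k, ∀ Δ ⊆ Γ, Deriv T Δ (φ.inst (Tm.var k)) → Deriv T Δ φ.all := by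
  have hΓ : ∃ k, ∀ ψ ∈ φ :: Γ, ∀ (σ σ' : ℕ → Tm) (ρ : ℕ → ℕ),
      (∀ n < k, σ n = σ' n) → ψ.subst σ ρ = ψ.subst σ' ρ := by
    induction (φ :: Γ) with
    | nil => exact ⟨0, by simp⟩
    | cons ψ L ih =>
      obtain ⟨k, hk⟩ := ih
      obtain ⟨l, hl⟩ := ψ.exists_bound
      refine ⟨max k l, fun χ hχ σ σ' ρ h => ?_⟩
      rcases List.mem_cons.1 hχ with rfl | hχ
      · exact hl σ σ' ρ fun n hn => h n (by omega)
      · exact hk χ hχ σ σ' ρ fun n hn => h n (by omega)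
  obtain ⟨k, hk⟩ := hΓ
  refine ⟨k, fun Δ hΔ h => .allI ?_⟩
  -- This renaming sends the fresh variable to `0` and shifts the others, so `φ(k)` becomes `φ` and
  -- the assumptions become their weakenings, as `allI` demands.
  have h := h.subst hT (fun n => if n = k then Tm.var 0 else Tm.var (n + 1)) id
  have e₁ : (φ.inst (Tm.var k)).subst (fun n => if n = k then Tm.var 0 else Tm.var (n + 1)) id
      = φ := by
    rw [Fml.inst_eq, Fml.subst_subst]
    refine (hk φ List.mem_cons_self _ Tm.var _ fun n hn => ?_).trans φ.subst_var
    cases n with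
    | zero => simp [Tm.subst]
    | succ n => simp [Tm.subst, (show n ≠ k by omega)]
  have e₂ : Δ.map (Fml.subst (fun n => if n = k then Tm.var 0 else Tm.var (n + 1)) id)
      = Δ.map Fml.shift := by
    refine List.map_congr_left fun ψ hψ => hk ψ (List.mem_cons_of_mem _ (hΔ hψ)) _ _ _ ?_
    intro n hn
    simp [hn.ne]
  rwa [e₁, e₂] at h

/-- Generalization over a set variable that is not free in the assumptions. -/
theorem exists_freshS (hT : SubstClosed T) (Γ : List Fml) (φ : Fml) :
    ∃ k, ∀ Δ ⊆ Γ, Deriv T Δ (φ.instS k) → Deriv T Δ φ.allS := by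
  have hΓ : ∃ k, ∀ ψ ∈ φ :: Γ, ∀ (σ : ℕ → Tm) (ρ ρ' : ℕ → ℕ),
      (∀ n < k, ρ n = ρ' n) → ψ.subst σ ρ = ψ.subst σ ρ' := by
    induction (φ :: Γ) with
    | nil => exact ⟨0, by simp⟩
    | cons ψ L ih =>
      obtain ⟨k, hk⟩ := ih
      obtain ⟨l, hl⟩ := ψ.exists_boundS
      refine ⟨max k l, fun χ hχ σ ρ ρ' h => ?_⟩
      rcases List.mem_cons.1 hχ with rfl | hχ
      · exact hl σ ρ ρ' fun n hn => h n (by omega)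
      · exact hk χ hχ σ ρ ρ' fun n hn => h n (by omega)
  obtain ⟨k, hk⟩ := hΓ
  refine ⟨k, fun Δ hΔ h => .allSI ?_⟩
  have h := h.subst hT Tm.var (fun n => if n = k then 0 else n + 1)
  have e₁ : (φ.instS k).subst Tm.var (fun n => if n = k then 0 else n + 1) = φ := by
    rw [Fml.instS_eq, Fml.subst_subst]
    refine (hk φ List.mem_cons_self _ _ id fun n hn => ?_).trans ?_
    · cases n with
      | zero => simp
      | succ n => simp [(show n ≠ k by omega)]
    · exact φ.subst_var
  have e₂ : Δ.map (Fml.subst Tm.var (fun n => if n = k then 0 else n + 1))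
      = Δ.map Fml.shiftS := by
    refine List.map_congr_left fun ψ hψ => hk ψ (List.mem_cons_of_mem _ (hΔ hψ)) _ _ _ ?_
    intro n hn
    simp [hn.ne]
  rwa [e₁, e₂] at h

theorem eq_symm {s t : Tm} (h : Deriv T Γ (.eq s t)) : Deriv T Γ (.eq t s) := by
  have := Deriv.eqSubst (Fml.eq (Tm.var 0) s.shift) h
    (by simpa [Fml.inst_eq, Fml.subst, Tm.subst, Tm.shift_subst_scons, Tm.subst_var]
        using Deriv.eqRefl s)
  simpa [Fml.inst_eq, Fml.subst, Tm.subst, Tm.shift_subst_scons, Tm.subst_var] using this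

theorem eq_trans {s t u : Tm} (h : Deriv T Γ (.eq s t)) (h' : Deriv T Γ (.eq t u)) :
    Deriv T Γ (.eq s u) := by
  have := Deriv.eqSubst (Fml.eq s.shift (Tm.var 0)) h'
    (by simpa [Fml.inst_eq, Fml.subst, Tm.subst, Tm.shift_subst_scons, Tm.subst_var] using h)
  simpa [Fml.inst_eq, Fml.subst, Tm.subst, Tm.shift_subst_scons, Tm.subst_var] using this

/-- Equal terms can be replaced in the value of a term. -/
theorem eq_congr {s t : Tm} (u : Tm) (h : Deriv T Γ (.eq s t)) :
    Deriv T Γ (.eq (u.subst (scons s Tm.var)) (u.subst (scons t Tm.var))) := by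
  have := Deriv.eqSubst (Fml.eq (u.subst (scons s Tm.var)).shift u) h
    (by simpa [Fml.inst_eq, Fml.subst, Tm.shift_subst_scons, Tm.subst_var]
        using Deriv.eqRefl (u.subst (scons s Tm.var)))
  simpa [Fml.inst_eq, Fml.subst, Tm.shift_subst_scons, Tm.subst_var] using this

end Deriv

end SOA

/-! ### Semantics -/

namespace SOA

/-- Structures for the language of second-order arithmetic. -/
structure Str where
  M : Type
  S : Type
  zero : M
  one : M
  add : M → M → M
  mul : M → M → M
  lt : M → M → Prop
  mem : M → S → Prop

/-- The value of a term. -/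
def Tm.eval (𝔄 : Str) (e : ℕ → 𝔄.M) : Tm → 𝔄.M
  | var n => e n
  | zero => 𝔄.zero
  | one => 𝔄.one
  | add s t => 𝔄.add (s.eval 𝔄 e) (t.eval 𝔄 e)
  | mul s t => 𝔄.mul (s.eval 𝔄 e) (t.eval 𝔄 e)

/-- Satisfaction of a formula. -/
def Fml.eval (𝔄 : Str) : (ℕ → 𝔄.M) → (ℕ → 𝔄.S) → Fml → Prop
  | _, _, bot => False
  | e, _, eq s t => s.eval 𝔄 e = t.eval 𝔄 e
  | e, _, lt s t => 𝔄.lt (s.eval 𝔄 e) (t.eval 𝔄 e)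
  | e, f, mem t X => 𝔄.mem (t.eval 𝔄 e) (f X)
  | e, f, imp φ ψ => Fml.eval 𝔄 e f φ → Fml.eval 𝔄 e f ψ
  | e, f, all φ => ∀ a, Fml.eval 𝔄 (scons a e) f φ
  | e, f, allS φ => ∀ A, Fml.eval 𝔄 e (scons A f) φ

/-- `𝔄` satisfies all axioms in `T` under all assignments. -/
def Str.IsModel (𝔄 : Str) (T : Set Fml) : Prop :=
  ∀ φ ∈ T, ∀ e f, φ.eval 𝔄 e f

section Eval
variable {𝔄 : Str} (e : ℕ → 𝔄.M) (f : ℕ → 𝔄.S)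

theorem Tm.eval_subst (σ : ℕ → Tm) (t : Tm) :
    (t.subst σ).eval 𝔄 e = t.eval 𝔄 (fun n => (σ n).eval 𝔄 e) := by
  induction t <;> simp_all [Tm.subst, Tm.eval]

@[simp] theorem Tm.eval_shift (a : 𝔄.M) (t : Tm) :
    t.shift.eval 𝔄 (scons a e) = t.eval 𝔄 e := by
  rw [Tm.shift, Tm.eval_subst]; rfl

theorem Fml.eval_subst (σ : ℕ → Tm) (ρ : ℕ → ℕ) (φ : Fml) :
    (φ.subst σ ρ).eval 𝔄 e f ↔ φ.eval 𝔄 (fun n => (σ n).eval 𝔄 e) (f ∘ ρ) := by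
  induction φ generalizing e f σ ρ with
  | bot => rfl
  | eq s t => simp [Fml.subst, Fml.eval, Tm.eval_subst]
  | lt s t => simp [Fml.subst, Fml.eval, Tm.eval_subst]
  | mem t X => simp [Fml.subst, Fml.eval, Tm.eval_subst]
  | imp φ ψ hφ hψ => simp [Fml.subst, Fml.eval, hφ, hψ]
  | all φ h =>
    simp only [Fml.subst, Fml.eval, h]
    refine forall_congr' fun a => ?_
    have : (fun n => (up σ n).eval 𝔄 (scons a e)) =
        scons a (fun n => (σ n).eval 𝔄 e) := by
      funext n; cases n <;> simp [up, Tm.eval]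
    rw [this]
  | allS φ h =>
    simp only [Fml.subst, Fml.eval, h, scons_comp_upS]

@[simp] theorem Fml.eval_inst (φ : Fml) (t : Tm) :
    (φ.inst t).eval 𝔄 e f ↔ φ.eval 𝔄 (scons (t.eval 𝔄 e) e) f := by
  rw [Fml.inst_eq, Fml.eval_subst]
  have : (fun n => (scons t Tm.var n).eval 𝔄 e) = scons (t.eval 𝔄 e) e := by
    funext n; cases n <;> rfl
  rw [this]; rfl

@[simp] theorem Fml.eval_succ (φ : Fml) (a : 𝔄.M) :
    φ.succ.eval 𝔄 (scons a e) f ↔ φ.eval 𝔄 (scons (𝔄.add a 𝔄.one) e) f := by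
  rw [Fml.succ_eq, Fml.eval_subst]
  have : (fun n => (scons (Tm.add (Tm.var 0) Tm.one) (fun n => Tm.var (n + 1)) n).eval 𝔄
      (scons a e)) = scons (𝔄.add a 𝔄.one) e := by
    funext n; cases n <;> rfl
  rw [this]; rfl

@[simp] theorem Fml.eval_shiftS (φ : Fml) (A : 𝔄.S) :
    φ.shiftS.eval 𝔄 e (scons A f) ↔ φ.eval 𝔄 e f := by
  rw [Fml.shiftS, Fml.eval_subst]; rfl

@[simp] theorem Fml.eval_neg (φ : Fml) : φ.neg.eval 𝔄 e f ↔ ¬ φ.eval 𝔄 e f := Iff.rfl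

@[simp] theorem Fml.eval_or (φ ψ : Fml) :
    (φ.or ψ).eval 𝔄 e f ↔ φ.eval 𝔄 e f ∨ ψ.eval 𝔄 e f := by
  simp only [Fml.or, Fml.eval, Fml.eval_neg]; tauto

@[simp] theorem Fml.eval_and (φ ψ : Fml) :
    (φ.and ψ).eval 𝔄 e f ↔ φ.eval 𝔄 e f ∧ ψ.eval 𝔄 e f := by
  simp only [Fml.and, Fml.eval, Fml.eval_neg]; tauto

@[simp] theorem Fml.eval_iff (φ ψ : Fml) :
    (φ.iff ψ).eval 𝔄 e f ↔ (φ.eval 𝔄 e f ↔ ψ.eval 𝔄 e f) := by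
  simp only [Fml.iff, Fml.eval, Fml.eval_and]; tauto

@[simp] theorem Fml.eval_ex (φ : Fml) :
    φ.ex.eval 𝔄 e f ↔ ∃ a, φ.eval 𝔄 (scons a e) f := by
  simp [Fml.ex, Fml.eval]

@[simp] theorem Fml.eval_exS (φ : Fml) :
    φ.exS.eval 𝔄 e f ↔ ∃ A, φ.eval 𝔄 e (scons A f) := by
  simp [Fml.exS, Fml.eval]

@[simp] theorem Fml.eval_exUnique (φ : Fml) :
    φ.exUnique.eval 𝔄 e f ↔ ∃! a, φ.eval 𝔄 (scons a e) f := by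
  have (a b : 𝔄.M) : (φ.subst (fun n => match n with
      | 0 => Tm.var 0 | k + 1 => Tm.var (k + 2)) id).eval 𝔄 (scons b (scons a e)) f ↔
      φ.eval 𝔄 (scons b e) f := by
    rw [Fml.eval_subst]
    have : (fun n => Tm.eval 𝔄 (scons b (scons a e)) (match n with
      | 0 => Tm.var 0 | k + 1 => Tm.var (k + 2))) = scons b e := by
      funext n; cases n <;> rfl
    rw [this]; rfl
  simp only [Fml.exUnique, Fml.eval_ex, Fml.eval_and]
  exact exists_congr fun a => and_congr Iff.rfl
    (forall_congr' fun b => imp_congr (this a b) Iff.rfl)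

end Eval

/-! ### The completeness theorem -/

/-- A code for a term. -/
def Tm.code : Tm → ℕ
  | var n => Nat.pair 0 n
  | zero => Nat.pair 1 0
  | one => Nat.pair 2 0
  | add s t => Nat.pair 3 (Nat.pair s.code t.code)
  | mul s t => Nat.pair 4 (Nat.pair s.code t.code)

/-- A code for a formula. -/
def Fml.code : Fml → ℕ
  | bot => Nat.pair 0 0
  | eq s t => Nat.pair 1 (Nat.pair s.code t.code)
  | lt s t => Nat.pair 2 (Nat.pair s.code t.code)
  | mem t X => Nat.pair 3 (Nat.pair t.code X)
  | imp φ ψ => Nat.pair 4 (Nat.pair φ.code ψ.code)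
  | all φ => Nat.pair 5 φ.code
  | allS φ => Nat.pair 6 φ.code

theorem Tm.code_injective : Function.Injective Tm.code := by
  intro s
  induction s with
  | var n => intro t h; cases t <;> simp_all [code, Nat.pair_eq_pair]
  | zero => intro t h; cases t <;> simp_all [code, Nat.pair_eq_pair]
  | one => intro t h; cases t <;> simp_all [code, Nat.pair_eq_pair]
  | add s₁ s₂ h₁ h₂ =>
    intro t h
    cases t <;> simp [code, Nat.pair_eq_pair] at h ⊢
    exact ⟨h₁ h.1, h₂ h.2⟩
  | mul s₁ s₂ h₁ h₂ =>
    intro t h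
    cases t <;> simp [code, Nat.pair_eq_pair] at h ⊢
    exact ⟨h₁ h.1, h₂ h.2⟩

theorem Fml.code_injective : Function.Injective Fml.code := by
  intro φ
  induction φ with
  | bot => intro ψ h; cases ψ <;> simp_all [code, Nat.pair_eq_pair]
  | eq s t | lt s t | mem t X =>
    intro ψ h
    cases ψ <;> simp_all [code, Nat.pair_eq_pair, Tm.code_injective.eq_iff]
  | imp φ₁ φ₂ h₁ h₂ =>
    intro ψ h
    cases ψ <;> simp [code, Nat.pair_eq_pair] at h ⊢
    exact ⟨h₁ h.1, h₂ h.2⟩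
  | all φ ih | allS φ ih =>
    intro ψ h
    cases ψ <;> simp [code, Nat.pair_eq_pair] at h ⊢
    exact ih h

/-- Countability lets the Henkin construction treat every formula at some finite stage. -/
instance : Countable Fml := Fml.code_injective.countable

section Henkin
variable {T : Set Fml}

/-- A finite consistent set of formulas has a finite consistent extension which decides `χ`, and
which contains a counterexample to `χ` if it refutes a universal formula `χ`. -/
theorem exists_henkin_extension (hT : SubstClosed T) (Γ : List Fml)
    (hΓ : ¬ Deriv T Γ Fml.bot) (χ : Fml) : ∃ Δ, Γ ⊆ Δ ∧ ¬ Deriv T Δ Fml.bot ∧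
      (χ ∈ Δ ∨ χ.neg ∈ Δ) ∧
      (∀ φ : Fml, χ = φ.all → χ ∈ Δ ∨ ∃ t, (φ.inst t).neg ∈ Δ) ∧
      (∀ φ : Fml, χ = φ.allS → χ ∈ Δ ∨ ∃ Y, (φ.instS Y).neg ∈ Δ) := by
  by_cases h : Deriv T (χ :: Γ) Fml.bot
  · have hΓ' : ¬ Deriv T (χ.neg :: Γ) Fml.bot := fun h' => hΓ (.impE (.impI h) (.raa h'))
    have hneg {ψ : Fml} (hψ : Deriv T (χ.neg :: Γ) ψ → Deriv T (χ.neg :: Γ) χ) :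
        ¬ Deriv T (ψ.neg :: χ.neg :: Γ) Fml.bot := fun h' =>
      hΓ' (.impE (.hyp (φ := χ.neg) List.mem_cons_self) (hψ (.raa h')))
    cases χ with
    | all φ =>
      obtain ⟨k, hk⟩ := Deriv.exists_fresh hT (φ.all.neg :: Γ) φ
      exact ⟨(φ.inst (Tm.var k)).neg :: φ.all.neg :: Γ, by simp, hneg (hk _ (by simp)), .inr (by simp),
        fun ψ hψ => (by cases hψ; exact .inr ⟨Tm.var k, by simp⟩), fun ψ hψ => by cases hψ⟩
    | allS φ =>
      obtain ⟨k, hk⟩ := Deriv.exists_freshS hT (φ.allS.neg :: Γ) φ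
      exact ⟨(φ.instS k).neg :: φ.allS.neg :: Γ, by simp, hneg (hk _ (by simp)), .inr (by simp),
        fun ψ hψ => (by cases hψ), fun ψ hψ => by cases hψ; exact .inr ⟨k, by simp⟩⟩
    | _ =>
      exact ⟨_ :: Γ, by simp, hΓ', .inr (by simp), fun ψ hψ => (by cases hψ), fun ψ hψ => by cases hψ⟩
  · exact ⟨χ :: Γ, by simp, h, by simp, by simp, by simp⟩

/-- A maximal consistent set of formulas with witnesses. -/
structure IsHenkin (T D : Set Fml) : Prop where
  closed : ∀ {Γ : List Fml} {φ : Fml}, (∀ ψ ∈ Γ, ψ ∈ D) → Deriv T Γ φ → φ ∈ D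
  neg_mem : ∀ φ : Fml, φ.neg ∈ D ↔ φ ∉ D
  all_mem : ∀ φ : Fml, φ.all ∈ D ↔ ∀ t, φ.inst t ∈ D
  allS_mem : ∀ φ : Fml, φ.allS ∈ D ↔ ∀ Y, φ.instS Y ∈ D

/-- Formulas are decided one by one along an enumeration. Every stage is a finite list, so unused
variables can serve as witnesses and no new constants are needed; the union of the stages is the
required set. -/
theorem exists_isHenkin (hT : SubstClosed T) {Γ : List Fml} (hΓ : ¬ Deriv T Γ Fml.bot) :
    ∃ D, IsHenkin T D ∧ ∀ φ ∈ Γ, φ ∈ D := by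
  have : Nonempty Fml := ⟨Fml.bot⟩
  obtain ⟨g, hg⟩ := exists_surjective_nat Fml
  choose F hF₁ hF₂ hF₃ hF₄ hF₅ using
    fun (Γ : {Γ : List Fml // ¬ Deriv T Γ Fml.bot}) => exists_henkin_extension hT Γ.1 Γ.2
  let G : ℕ → {Γ : List Fml // ¬ Deriv T Γ Fml.bot} := fun n =>
    Nat.rec ⟨Γ, hΓ⟩ (fun n Δ => ⟨F Δ (g n), hF₂ Δ (g n)⟩) n
  have hG (n : ℕ) : (G (n + 1)).1 = F (G n) (g n) := rfl
  have hmono : ∀ m n, m ≤ n → (G m).1 ⊆ (G n).1 := by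
    intro m n h
    induction h with
    | refl => exact List.Subset.refl _
    | step _ ih => exact List.Subset.trans ih (by rw [hG]; exact hF₁ _ _)
  let D : Set Fml := {φ | ∃ n, φ ∈ (G n).1}
  have hfin (Δ : List Fml) (h : ∀ φ ∈ Δ, φ ∈ D) : ∃ n, Δ ⊆ (G n).1 := by
    induction Δ with
    | nil => exact ⟨0, List.nil_subset _⟩
    | cons φ Δ ih =>
      obtain ⟨m, hm⟩ := h φ List.mem_cons_self
      obtain ⟨n, hn⟩ := ih fun ψ hψ => h ψ (List.mem_cons_of_mem _ hψ)
      refine ⟨max m n, List.cons_subset.2 ⟨hmono m _ (le_max_left _ _) hm,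
        List.Subset.trans hn (hmono n _ (le_max_right _ _))⟩⟩
  have hcons (Δ : List Fml) (h : ∀ φ ∈ Δ, φ ∈ D) : ¬ Deriv T Δ Fml.bot := fun hΔ => by
    obtain ⟨n, hn⟩ := hfin Δ h
    exact (G n).2 (hΔ.weaken hn)
  have hdec (φ : Fml) : φ ∈ D ∨ φ.neg ∈ D := by
    obtain ⟨n, rfl⟩ := hg φ
    exact (hF₃ (G n) (g n)).imp (fun h => ⟨n + 1, h⟩) (fun h => ⟨n + 1, h⟩)
  have hclosed {Δ : List Fml} {φ : Fml} (h : ∀ ψ ∈ Δ, ψ ∈ D) (hφ : Deriv T Δ φ) : φ ∈ D := by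
    refine (hdec φ).resolve_right fun hn => hcons (φ.neg :: Δ) ?_ ?_
    · simpa using ⟨hn, h⟩
    · exact .impE (.hyp (φ := φ.neg) List.mem_cons_self)
        (hφ.weaken (List.subset_cons_self _ _))
  have hneg (φ : Fml) : φ.neg ∈ D ↔ φ ∉ D := by
    refine ⟨fun h h' => hcons [φ.neg, φ] (by simp [h, h']) ?_, (hdec φ).resolve_left⟩
    exact .impE (.hyp (φ := φ.neg) (by simp)) (.hyp (by simp))
  refine ⟨D, ⟨hclosed, hneg, fun φ => ⟨fun h t => ?_, fun h => ?_⟩,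
    fun φ => ⟨fun h t => ?_, fun h => ?_⟩⟩, fun φ h => ⟨0, h⟩⟩
  · exact hclosed (Δ := [φ.all]) (by simpa using h) (.allE t (.hyp (by simp)))
  · obtain ⟨n, hn⟩ := hg φ.all
    rcases hF₄ (G n) (g n) φ hn with h' | ⟨t, ht⟩
    · exact hn ▸ ⟨n + 1, h'⟩
    · exact absurd (h t) ((hneg _).1 ⟨n + 1, ht⟩)
  · exact hclosed (Δ := [φ.allS]) (by simpa using h) (.allSE t (.hyp (by simp)))
  · obtain ⟨n, hn⟩ := hg φ.allS
    rcases hF₅ (G n) (g n) φ hn with h' | ⟨t, ht⟩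
    · exact hn ▸ ⟨n + 1, h'⟩
    · exact absurd (h t) ((hneg _).1 ⟨n + 1, ht⟩)

namespace IsHenkin
variable {D : Set Fml} (hD : IsHenkin T D)
include hD

theorem imp_mem (φ ψ : Fml) : φ.imp ψ ∈ D ↔ (φ ∈ D → ψ ∈ D) := by
  refine ⟨fun h h' => hD.closed (Γ := [φ.imp ψ, φ]) (by simp [h, h'])
    (.impE (.hyp (φ := φ.imp ψ) (by simp)) (.hyp (by simp))), fun h => ?_⟩
  by_cases hφ : φ ∈ D
  · exact hD.closed (Γ := [ψ]) (by simpa using h hφ) (.impI (.hyp (by simp)))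
  · refine hD.closed (Γ := [φ.neg]) (by simpa using (hD.neg_mem φ).2 hφ) (.impI ?_)
    exact Deriv.exfalso (.impE (.hyp (φ := φ.neg) (by simp)) (.hyp (by simp)))

/-- Provable equality of terms. -/
def setoid : Setoid Tm where
  r s t := Fml.eq s t ∈ D
  iseqv :=
    { refl := fun t => hD.closed (Γ := []) (by simp) (.eqRefl t)
      symm := fun h => hD.closed (Γ := [_]) (by simpa using h) (.eq_symm (.hyp (by simp)))
      trans := fun {s t u} h h' => hD.closed (Γ := [.eq s t, .eq t u]) (by simp [h, h'])
        (.eq_trans (t := t) (.hyp (by simp)) (.hyp (by simp))) }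

theorem inst_mem {s t : Tm} (φ : Fml) (h : Fml.eq s t ∈ D) (hs : φ.inst s ∈ D) :
    φ.inst t ∈ D :=
  hD.closed (Γ := [.eq s t, φ.inst s]) (by simp [h, hs])
    (.eqSubst φ (s := s) (.hyp (by simp)) (.hyp (by simp)))

theorem eq_congr {s t : Tm} (u : Tm) (h : Fml.eq s t ∈ D) :
    Fml.eq (u.subst (scons s Tm.var)) (u.subst (scons t Tm.var)) ∈ D :=
  hD.closed (Γ := [.eq s t]) (by simpa using h) (.eq_congr u (.hyp (by simp)))

theorem eq_trans {s t u : Tm} (h : Fml.eq s t ∈ D) (h' : Fml.eq t u ∈ D) : Fml.eq s u ∈ D :=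
  hD.setoid.iseqv.trans h h'

/-- The term model. -/
def model : Str where
  M := Quotient hD.setoid
  -- The set variables themselves serve as sets: the language has no equality between sets, so no
  -- quotient is required.
  S := ℕ
  zero := Quotient.mk _ Tm.zero
  one := Quotient.mk _ Tm.one
  add := Quotient.map₂ Tm.add (by
    intro s s' h t t' h'
    have h₁ := hD.eq_congr (Tm.add (Tm.var 0) t.shift) h
    have h₂ := hD.eq_congr (Tm.add s'.shift (Tm.var 0)) h'
    simp only [Tm.subst, Tm.shift_subst_scons, Tm.subst_var, scons_zero] at h₁ h₂
    exact hD.eq_trans h₁ h₂)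
  mul := Quotient.map₂ Tm.mul (by
    intro s s' h t t' h'
    have h₁ := hD.eq_congr (Tm.mul (Tm.var 0) t.shift) h
    have h₂ := hD.eq_congr (Tm.mul s'.shift (Tm.var 0)) h'
    simp only [Tm.subst, Tm.shift_subst_scons, Tm.subst_var, scons_zero] at h₁ h₂
    exact hD.eq_trans h₁ h₂)
  lt := Quotient.lift₂ (fun s t => Fml.lt s t ∈ D) (by
    have key : ∀ {s t s' t' : Tm}, Fml.eq s s' ∈ D → Fml.eq t t' ∈ D → Fml.lt s t ∈ D →
        Fml.lt s' t' ∈ D := by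
      intro s t s' t' h h' hl
      have h₁ := hD.inst_mem (Fml.lt (Tm.var 0) t.shift) h
      have h₂ := hD.inst_mem (Fml.lt s'.shift (Tm.var 0)) h'
      simp only [Fml.inst_eq, Fml.subst, Tm.subst, Tm.shift_subst_scons, Tm.subst_var,
        scons_zero] at h₁ h₂
      exact h₂ (h₁ hl)
    intro s t s' t' h h'
    exact propext ⟨key h h', key (hD.setoid.iseqv.symm h) (hD.setoid.iseqv.symm h')⟩)
  mem q X := Quotient.lift (fun t => Fml.mem t X ∈ D) (by
    have key : ∀ {t t' : Tm}, Fml.eq t t' ∈ D → Fml.mem t X ∈ D → Fml.mem t' X ∈ D := by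
      intro t t' h
      have h₁ := hD.inst_mem (Fml.mem (Tm.var 0) X) h
      simpa only [Fml.inst_eq, Fml.subst, Tm.subst, scons_zero, id] using h₁
    intro t t' h
    exact propext ⟨key h, key (hD.setoid.iseqv.symm h)⟩) q

theorem eval_tm (σ : ℕ → Tm) (t : Tm) :
    t.eval hD.model (fun n => Quotient.mk _ (σ n)) = Quotient.mk hD.setoid (t.subst σ) := by
  induction t with
  | add s t hs ht => simp only [Tm.eval, hs, ht, Tm.subst]; rfl
  | mul s t hs ht => simp only [Tm.eval, hs, ht, Tm.subst]; rfl
  | _ => rfl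

/-- The truth lemma: the Henkin properties match the clauses of satisfaction, since every element of
the model is named by a term or a set variable. -/
theorem eval_iff (φ : Fml) (σ : ℕ → Tm) (ρ : ℕ → ℕ) :
    φ.eval hD.model (fun n => Quotient.mk _ (σ n)) ρ ↔ φ.subst σ ρ ∈ D := by
  induction φ generalizing σ ρ with
  | bot =>
    refine iff_of_false id fun h => ?_
    have h' : Fml.bot.neg ∈ D := hD.closed (Γ := []) (by simp) (.impI (.hyp (by simp)))
    exact (hD.neg_mem _).1 h' h
  | eq s t =>
    simp only [Fml.eval, hD.eval_tm]
    exact Quotient.eq (r := hD.setoid)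
  | lt s t => simp only [Fml.eval, hD.eval_tm]; rfl
  | mem t X => simp only [Fml.eval, hD.eval_tm]; rfl
  | imp φ ψ hφ hψ => simp only [Fml.eval, hφ, hψ, Fml.subst, hD.imp_mem]
  | all φ h =>
    have key (t : Tm) : φ.eval hD.model (scons (Quotient.mk hD.setoid t)
        fun n => Quotient.mk hD.setoid (σ n)) ρ ↔ φ.subst (scons t σ) ρ ∈ D := by
      rw [← h]
      have : (scons (Quotient.mk hD.setoid t) fun n => Quotient.mk hD.setoid (σ n)) =
          fun n => Quotient.mk hD.setoid (scons t σ n) := by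
        funext n; cases n <;> rfl
      exact iff_of_eq (congrArg (fun e => Fml.eval hD.model e ρ φ) this)
    simp only [Fml.subst, hD.all_mem, Fml.subst_up_inst]
    exact ⟨fun H t => (key t).1 (H _),
      fun H a => Quotient.inductionOn a fun t => (key t).2 (H t)⟩
  | allS φ h =>
    simp only [Fml.subst, hD.allS_mem, Fml.subst_upS_instS]
    exact forall_congr' fun Y => h σ (scons Y ρ)

end IsHenkin

/-- The completeness theorem. -/
theorem provable_of_models (hT : SubstClosed T) (φ : Fml)
    (h : ∀ 𝔄 : Str, 𝔄.IsModel T → ∀ e f, φ.eval 𝔄 e f) : Provable T φ := by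
  by_contra hφ
  obtain ⟨D, hD, hmem⟩ := exists_isHenkin hT (Γ := [φ.neg]) fun h' => hφ (.raa h')
  have hmodel : hD.model.IsModel T := by
    intro ψ hψ e ρ
    obtain ⟨σ, rfl⟩ : ∃ σ : ℕ → Tm, (fun n => Quotient.mk hD.setoid (σ n)) = e :=
      ⟨fun n => (e n).out, funext fun n => Quotient.out_eq _⟩
    exact (hD.eval_iff ψ σ ρ).2 (hD.closed (Γ := []) (by simp) (hT ψ hψ σ ρ))
  have h₁ := (hD.eval_iff φ Tm.var id).1 (h hD.model hmodel _ _)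
  rw [Fml.subst_var] at h₁
  exact (hD.neg_mem φ).1 (hmem _ (by simp)) h₁

end Henkin

/-! ### Substitution instances of the axioms -/

theorem IsSigma00.subst {φ : Fml} (h : IsSigma00 φ) (σ : ℕ → Tm) (ρ : ℕ → ℕ) :
    IsSigma00 (φ.subst σ ρ) := by
  induction h generalizing σ with
  | bot => exact .bot
  | eq s t => exact .eq _ _
  | lt s t => exact .lt _ _
  | mem t X => exact .mem _ _
  | imp _ _ ih₁ ih₂ => exact .imp (ih₁ σ) (ih₂ σ)
  | ball t _ ih =>
    have := IsSigma00.ball (t.subst σ) (ih (up σ))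
    rwa [← Tm.shift_subst_up] at this
  | bex t _ ih =>
    have := IsSigma00.bex (t.subst σ) (ih (up σ))
    rwa [← Tm.shift_subst_up] at this

theorem IsSigma01.subst {φ : Fml} (h : IsSigma01 φ) (σ : ℕ → Tm) (ρ : ℕ → ℕ) :
    IsSigma01 (φ.subst σ ρ) := by
  obtain ⟨θ, hθ, rfl⟩ := h
  exact ⟨_, hθ.subst (up σ) ρ, rfl⟩

theorem IsPi01.subst {φ : Fml} (h : IsPi01 φ) (σ : ℕ → Tm) (ρ : ℕ → ℕ) :
    IsPi01 (φ.subst σ ρ) := by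
  obtain ⟨θ, hθ, rfl⟩ := h
  exact ⟨_, hθ.subst (up σ) ρ, rfl⟩

/-- The substitution `s, t` for the variables `0, 1` of a derivable formula. -/
theorem Deriv.inst_two {T : Set Fml} {φ : Fml} (h : Deriv T [] φ) (s t : Tm) :
    Deriv T [] (φ.subst (scons s (scons t Tm.var)) id) := by
  have h₁ : Deriv T [] φ.all.all := .allI (.allI h)
  have h₂ := Deriv.allE s (Deriv.allE t h₁)
  rw [Fml.subst_up_inst] at h₂
  exact h₂

/-- Both schemes allow arbitrary parameters and substitution preserves the formula classes, so
instances go to instances. The basic axioms contain only the variables `0` and `1`, which are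
generalized and instantiated. -/
theorem RCA0_substClosed : SubstClosed RCA0 := by
  rintro φ ((hφ | ⟨φ, h, rfl⟩) | ⟨φ, ψ, h, h', rfl⟩) σ ρ
  · have h := (Deriv.ax (Γ := []) (show φ ∈ RCA0 from .inl (.inl hφ))).inst_two (σ 0) (σ 1)
    simp only [basicAxioms, Set.mem_insert_iff, Set.mem_singleton_iff] at hφ
    rcases hφ with rfl | rfl | rfl | rfl | rfl | rfl | rfl | rfl <;> exact h
  · refine .ax (.inl (.inr ⟨φ.subst (up σ) ρ, h.subst _ _, ?_⟩))
    simp only [induction, Fml.subst, Fml.and, Fml.neg, Fml.inst_subst, Fml.succ_subst_up]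
    rfl
  · refine .ax (.inr ⟨φ.subst (up σ) ρ, ψ.subst (up σ) ρ, h.subst _ _, h'.subst _ _, ?_⟩)
    simp only [comprehension, Fml.subst, Fml.iff, Fml.exS, Fml.and, Fml.neg,
      Fml.shiftS_subst_upS]
    rfl

end SOA

/-! ### Definable predicates

Predicates of environments which are defined by `Σ⁰₀` formulas with parameters. -/

namespace SOA

section Notation
variable {𝔄 : Str}

instance : Zero 𝔄.M := ⟨𝔄.zero⟩
instance : One 𝔄.M := ⟨𝔄.one⟩
instance : Add 𝔄.M := ⟨𝔄.add⟩
instance : Mul 𝔄.M := ⟨𝔄.mul⟩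
instance : LT 𝔄.M := ⟨𝔄.lt⟩
instance : Membership 𝔄.M 𝔄.S := ⟨fun X x => 𝔄.mem x X⟩

variable (e : ℕ → 𝔄.M) (f : ℕ → 𝔄.S)

@[simp] theorem Tm.eval_var (n : ℕ) : (Tm.var n).eval 𝔄 e = e n := rfl
@[simp] theorem Tm.eval_zero : Tm.zero.eval 𝔄 e = 0 := rfl
@[simp] theorem Tm.eval_one : Tm.one.eval 𝔄 e = 1 := rfl
@[simp] theorem Tm.eval_add (s t : Tm) :
    (Tm.add s t).eval 𝔄 e = s.eval 𝔄 e + t.eval 𝔄 e := rfl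
@[simp] theorem Tm.eval_mul (s t : Tm) :
    (Tm.mul s t).eval 𝔄 e = s.eval 𝔄 e * t.eval 𝔄 e := rfl
@[simp] theorem Fml.eval_eq (s t : Tm) :
    (Fml.eq s t).eval 𝔄 e f ↔ s.eval 𝔄 e = t.eval 𝔄 e := Iff.rfl
@[simp] theorem Fml.eval_lt (s t : Tm) :
    (Fml.lt s t).eval 𝔄 e f ↔ s.eval 𝔄 e < t.eval 𝔄 e := Iff.rfl
@[simp] theorem Fml.eval_mem (t : Tm) (X : ℕ) :
    (Fml.mem t X).eval 𝔄 e f ↔ t.eval 𝔄 e ∈ f X := Iff.rfl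
@[simp] theorem Fml.eval_imp (φ ψ : Fml) :
    (φ.imp ψ).eval 𝔄 e f ↔ (φ.eval 𝔄 e f → ψ.eval 𝔄 e f) := Iff.rfl
@[simp] theorem Fml.eval_all (φ : Fml) :
    φ.all.eval 𝔄 e f ↔ ∀ a, φ.eval 𝔄 (scons a e) f := Iff.rfl
@[simp] theorem Fml.eval_allS (φ : Fml) :
    φ.allS.eval 𝔄 e f ↔ ∀ A, φ.eval 𝔄 e (scons A f) := Iff.rfl

end Notation

/-- The sequence `a 0, b 0, a 1, b 1, …`. -/
def join {α : Type} (a b : ℕ → α) (n : ℕ) : α := if n % 2 = 0 then a (n / 2) else b (n / 2)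

theorem join_even {α : Type} (a b : ℕ → α) (n : ℕ) : join a b (2 * n) = a n := by
  simp [join]

theorem join_odd {α : Type} (a b : ℕ → α) (n : ℕ) : join a b (2 * n + 1) = b n := by
  have h : (2 * n + 1) / 2 = n := by omega
  simp [join, h, Nat.add_mod]

section Definable
variable {𝔄 : Str}

/-- The assignment which maps each variable to an entry of `e` or to a parameter. -/
def assign (v : ℕ → ℕ ⊕ 𝔄.M) (e : ℕ → 𝔄.M) (n : ℕ) : 𝔄.M := Sum.elim e id (v n)

/-- `t` is the value of a term with parameters. -/
class DefTm (t : (ℕ → 𝔄.M) → 𝔄.M) : Prop where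
  out : ∃ (s : Tm) (v : ℕ → ℕ ⊕ 𝔄.M), ∀ e, s.eval 𝔄 (assign v e) = t e

/-- `P` is defined by a `Σ⁰₀` formula with parameters. -/
class Def0 (P : (ℕ → 𝔄.M) → Prop) : Prop where
  out : ∃ φ, IsSigma00 φ ∧ ∃ (v : ℕ → ℕ ⊕ 𝔄.M) (f : ℕ → 𝔄.S),
    ∀ e, φ.eval 𝔄 (assign v e) f ↔ P e

theorem assign_join_left (v w : ℕ → ℕ ⊕ 𝔄.M) (e : ℕ → 𝔄.M) :
    (fun n => (Tm.var (2 * n)).eval 𝔄 (assign (join v w) e)) = assign v e := by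
  funext n; simp [assign, join_even]

theorem assign_join_right (v w : ℕ → ℕ ⊕ 𝔄.M) (e : ℕ → 𝔄.M) :
    (fun n => (Tm.var (2 * n + 1)).eval 𝔄 (assign (join v w) e)) = assign w e := by
  funext n; simp [assign, join_odd]

theorem DefTm.out₂ (s t : (ℕ → 𝔄.M) → 𝔄.M) [hs : DefTm s] [ht : DefTm t] :
    ∃ (s' t' : Tm) (v : ℕ → ℕ ⊕ 𝔄.M), ∀ e,
      s'.eval 𝔄 (assign v e) = s e ∧ t'.eval 𝔄 (assign v e) = t e := by
  obtain ⟨s', v, h⟩ := hs.out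
  obtain ⟨t', w, h'⟩ := ht.out
  refine ⟨s'.subst fun n => .var (2 * n), t'.subst fun n => .var (2 * n + 1), join v w,
    fun e => ⟨?_, ?_⟩⟩
  · rw [Tm.eval_subst, assign_join_left, h]
  · rw [Tm.eval_subst, assign_join_right, h']

theorem Def0.congr {P Q : (ℕ → 𝔄.M) → Prop} (hP : Def0 P) (h : ∀ e, P e ↔ Q e) : Def0 Q := by
  obtain rfl : P = Q := funext fun e => propext (h e)
  exact hP

instance DefTm.var (n : ℕ) : DefTm (𝔄 := 𝔄) (fun e => e n) := ⟨.var n, .inl, fun _ => rfl⟩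

instance DefTm.const (a : 𝔄.M) : DefTm (𝔄 := 𝔄) (fun _ => a) :=
  ⟨.var 0, fun _ => .inr a, fun _ => rfl⟩

instance DefTm.add (s t : (ℕ → 𝔄.M) → 𝔄.M) [DefTm s] [DefTm t] :
    DefTm (fun e => s e + t e) := by
  obtain ⟨s', t', v, h⟩ := DefTm.out₂ s t
  exact ⟨.add s' t', v, fun e => by simp [h]⟩

instance DefTm.mul (s t : (ℕ → 𝔄.M) → 𝔄.M) [DefTm s] [DefTm t] :
    DefTm (fun e => s e * t e) := by
  obtain ⟨s', t', v, h⟩ := DefTm.out₂ s t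
  exact ⟨.mul s' t', v, fun e => by simp [h]⟩

instance Def0.mem (t : (ℕ → 𝔄.M) → 𝔄.M) (X : 𝔄.S) [ht : DefTm t] :
    Def0 (fun e => t e ∈ X) := by
  obtain ⟨t', v, h⟩ := ht.out
  exact ⟨.mem t' 0, .mem _ _, v, fun _ => X, fun e => by simp [h]⟩

instance Def0.imp (P Q : (ℕ → 𝔄.M) → Prop) [hP : Def0 P] [hQ : Def0 Q] :
    Def0 (fun e => P e → Q e) := by
  obtain ⟨φ, hφ, v, f, h⟩ := hP.out
  obtain ⟨ψ, hψ, w, g, h'⟩ := hQ.out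
  refine ⟨(φ.subst (fun n => .var (2 * n)) (fun n => 2 * n)).imp
    (ψ.subst (fun n => .var (2 * n + 1)) (fun n => 2 * n + 1)),
    .imp (hφ.subst _ _) (hψ.subst _ _), join v w, join f g, fun e => ?_⟩
  have hf : (join f g ∘ fun n => 2 * n) = f := funext fun n => join_even f g n
  have hg : (join f g ∘ fun n => 2 * n + 1) = g := funext fun n => join_odd f g n
  rw [Fml.eval_imp, Fml.eval_subst, Fml.eval_subst, assign_join_left, assign_join_right, hf, hg,
    h, h']

/-- The body sees the bound variable as entry `0` and the outer environment as its tail. Hence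
variables of `φ` that read entry `0` are renamed to the bound variable, and all others read one
entry lower. -/
instance Def0.ball (t : (ℕ → 𝔄.M) → 𝔄.M) (P : 𝔄.M → (ℕ → 𝔄.M) → Prop) [ht : DefTm t]
    [hP : Def0 fun e => P (e 0) fun n => e (n + 1)] :
    Def0 (fun e => ∀ x, x < t e → P x e) := by
  obtain ⟨s, v, h⟩ := ht.out
  obtain ⟨φ, hφ, w, f, h'⟩ := hP.out
  let τ : ℕ → Tm := fun n => match w n with
    | .inl 0 => .var 0
    | _ => .var (2 * n + 1 + 1)
  let w' : ℕ → ℕ ⊕ 𝔄.M := fun n => match w n with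
    | .inl (k + 1) => .inl k
    | .inl 0 => .inl 0
    | .inr a => .inr a
  refine ⟨.all (.imp (.lt (.var 0) (s.subst fun n => .var (2 * n)).shift) (φ.subst τ id)),
    .ball _ (hφ.subst _ _), join v w', f, fun e => ?_⟩
  have key (x : 𝔄.M) : (fun n => (τ n).eval 𝔄 (scons x (assign (join v w') e))) =
      assign w (scons x e) := by
    funext n
    simp only [τ, assign]
    rcases hw : w n with (_ | k) | a
    · simp
    · simp [assign, join_odd, w', hw]
    · simp [assign, join_odd, w', hw]
  simp only [Fml.eval_all, Fml.eval_imp, Fml.eval_lt, Tm.eval_var, scons_zero, Tm.eval_shift,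
    Tm.eval_subst, Fml.eval_subst, key]
  refine forall_congr' fun x => imp_congr ?_ ?_
  · have := assign_join_left v w' e
    simp only [Tm.eval_var] at this
    rw [this, h]
  · exact h' (scons x e)

/-- A definable binary predicate is defined by a `Σ⁰₀` formula in the variables `0` and `1`. -/
theorem Def0.out₂ (P : 𝔄.M → 𝔄.M → Prop) [hP : Def0 fun e => P (e 1) (e 0)] :
    ∃ φ, IsSigma00 φ ∧ ∃ (c : ℕ → 𝔄.M) (f : ℕ → 𝔄.S),
      ∀ x y, φ.eval 𝔄 (scons y (scons x c)) f ↔ P x y := by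
  obtain ⟨φ, hφ, v, f, h⟩ := hP.out
  let τ : ℕ → Tm := fun n => match v n with
    | .inl 0 => .var 0
    | .inl 1 => .var 1
    | _ => .var (n + 2)
  let c : ℕ → 𝔄.M := fun n => Sum.elim (fun _ => 0) id (v n)
  refine ⟨φ.subst τ id, hφ.subst _ _, c, f, fun x y => ?_⟩
  have key : (fun n => (τ n).eval 𝔄 (scons y (scons x c))) =
      assign v (scons y (scons x fun _ => 0)) := by
    funext n
    simp only [τ, assign]
    rcases hv : v n with (_ | _ | k) | a <;> simp [c, hv]
  rw [Fml.eval_subst, key]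
  exact h _

-- Even a formula without set variables is evaluated under an assignment of sets, so some set must
-- exist.
variable [Nonempty 𝔄.S]

instance Def0.eq (s t : (ℕ → 𝔄.M) → 𝔄.M) [DefTm s] [DefTm t] :
    Def0 (fun e => s e = t e) := by
  obtain ⟨s', t', v, h⟩ := DefTm.out₂ s t
  exact ⟨.eq s' t', .eq _ _, v, fun _ => Classical.arbitrary _, fun e => by simp [h]⟩

instance Def0.lt (s t : (ℕ → 𝔄.M) → 𝔄.M) [DefTm s] [DefTm t] :
    Def0 (fun e => s e < t e) := by
  obtain ⟨s', t', v, h⟩ := DefTm.out₂ s t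
  exact ⟨.lt s' t', .lt _ _, v, fun _ => Classical.arbitrary _, fun e => by simp [h]⟩

instance Def0.false : Def0 (𝔄 := 𝔄) (fun _ => False) :=
  ⟨.bot, .bot, .inl, fun _ => Classical.arbitrary _, fun _ => Iff.rfl⟩

instance Def0.not (P : (ℕ → 𝔄.M) → Prop) [Def0 P] : Def0 (fun e => ¬ P e) :=
  Def0.imp P fun _ => False

instance Def0.or (P Q : (ℕ → 𝔄.M) → Prop) [Def0 P] [Def0 Q] : Def0 (fun e => P e ∨ Q e) :=
  (inferInstance : Def0 fun e => ¬ P e → Q e).congr fun e => by tauto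

instance Def0.and (P Q : (ℕ → 𝔄.M) → Prop) [Def0 P] [Def0 Q] : Def0 (fun e => P e ∧ Q e) :=
  (inferInstance : Def0 fun e => ¬ (P e → ¬ Q e)).congr fun e => by tauto

instance Def0.iff (P Q : (ℕ → 𝔄.M) → Prop) [Def0 P] [Def0 Q] : Def0 (fun e => P e ↔ Q e) :=
  (inferInstance : Def0 fun e => (P e → Q e) ∧ (Q e → P e)).congr fun e => by tauto

instance Def0.bex (t : (ℕ → 𝔄.M) → 𝔄.M) (P : 𝔄.M → (ℕ → 𝔄.M) → Prop) [DefTm t]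
    [Def0 fun e => P (e 0) fun n => e (n + 1)] :
    Def0 (fun e => ∃ x, x < t e ∧ P x e) :=
  (inferInstance : Def0 fun e => ¬ ∀ x, x < t e → ¬ P x e).congr fun e => by
    simp only [not_forall, not_not, exists_prop]

end Definable

/-! ### Models of RCA₀ -/

/-- `𝔄` is a model of RCA₀. -/
class Str.RCA (𝔄 : Str) : Prop where
  model : 𝔄.IsModel RCA0
  nonempty : Nonempty 𝔄.S

section Model
variable {𝔄 : Str} [h𝔄 : 𝔄.RCA]

instance : Nonempty 𝔄.S := h𝔄.nonempty

/-- `Σ⁰₁` induction. -/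
theorem sigma_induction (P : 𝔄.M → 𝔄.M → Prop) [hP : Def0 fun e => P (e 1) (e 0)]
    (h0 : ∃ y, P 0 y) (hs : ∀ x y, P x y → ∃ z, P (x + 1) z) (x : 𝔄.M) : ∃ y, P x y := by
  obtain ⟨φ, hφ, c, f, h⟩ := Def0.out₂ P
  have := h𝔄.model (induction φ.ex) (.inl (.inr ⟨φ.ex, ⟨φ, hφ, rfl⟩, rfl⟩)) c f
  simp only [induction, Fml.eval_imp, Fml.eval_and, Fml.eval_inst, Fml.eval_all, Fml.eval_ex,
    Fml.eval_succ, h, Tm.eval_zero] at this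
  exact this ⟨h0, fun x ⟨y, hy⟩ => hs x y hy⟩ x

/-- `Σ⁰₀` induction. -/
theorem def_induction (P : 𝔄.M → Prop) [hP : Def0 fun e => P (e 1)]
    (h0 : P 0) (hs : ∀ x, P x → P (x + 1)) (x : 𝔄.M) : P x := by
  obtain ⟨_, h⟩ := sigma_induction (fun x _ => P x) ⟨0, h0⟩ (fun x _ h => ⟨0, hs x h⟩) x
  exact h

/-- `Σ⁰₀` comprehension. -/
theorem def_comprehension (P : 𝔄.M → Prop) [hP : Def0 fun e => P (e 1)] :
    ∃ X : 𝔄.S, ∀ x, x ∈ X ↔ P x := by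
  obtain ⟨φ, hφ, c, f, h⟩ := Def0.out₂ (fun x _ => P x)
  -- A dummy quantifier in front of the same matrix presents the predicate as both `Σ⁰₁` and `Π⁰₁`.
  have := h𝔄.model (comprehension φ.ex φ.all)
    (.inr ⟨φ.ex, φ.all, ⟨φ, hφ, rfl⟩, ⟨φ, hφ, rfl⟩, rfl⟩) c f
  have hne : Nonempty 𝔄.M := ⟨0⟩
  simpa only [comprehension, Fml.eval_imp, Fml.eval_all, Fml.eval_iff, Fml.eval_ex, h,
    exists_const, forall_const, implies_true, true_imp_iff, Fml.eval_exS, Fml.eval_mem,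
    Fml.eval_shiftS, Tm.eval_var, scons_zero] using this

/-! ### The ordered semiring of numbers -/

section Arithmetic

theorem eval_basic {φ : Fml} (h : φ ∈ basicAxioms) (x y : 𝔄.M) :
    φ.eval 𝔄 (scons x (scons y fun _ => 0)) fun _ => Classical.arbitrary _ :=
  h𝔄.model φ (.inl (.inl h)) _ _

theorem succ_ne_zero (x : 𝔄.M) : x + 1 ≠ 0 :=
  eval_basic (φ := .neg (.eq (.add (.var 0) .one) .zero)) (by simp [basicAxioms]) x x

theorem succ_inj {x y : 𝔄.M} : x + 1 = y + 1 → x = y :=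
  eval_basic (φ := .imp (.eq (.add (.var 0) .one) (.add (.var 1) .one)) (.eq (.var 0) (.var 1)))
    (by simp [basicAxioms]) x y

theorem add_zero' (x : 𝔄.M) : x + 0 = x :=
  eval_basic (φ := .eq (.add (.var 0) .zero) (.var 0)) (by simp [basicAxioms]) x x

theorem add_succ (x y : 𝔄.M) : x + (y + 1) = x + y + 1 :=
  eval_basic (φ := .eq (.add (.var 0) (.add (.var 1) .one)) (.add (.add (.var 0) (.var 1)) .one))
    (by simp [basicAxioms]) x y

theorem mul_zero' (x : 𝔄.M) : x * 0 = 0 :=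
  eval_basic (φ := .eq (.mul (.var 0) .zero) .zero) (by simp [basicAxioms]) x x

theorem mul_succ (x y : 𝔄.M) : x * (y + 1) = x * y + x :=
  eval_basic (φ := .eq (.mul (.var 0) (.add (.var 1) .one)) (.add (.mul (.var 0) (.var 1)) (.var 0)))
    (by simp [basicAxioms]) x y

theorem not_lt_zero' (x : 𝔄.M) : ¬ x < 0 :=
  eval_basic (φ := .neg (.lt (.var 0) .zero)) (by simp [basicAxioms]) x x

theorem lt_succ (x y : 𝔄.M) : x < y + 1 ↔ x < y ∨ x = y := by
  simpa using eval_basic (φ := .iff (.lt (.var 0) (.add (.var 1) .one))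
    (.or (.lt (.var 0) (.var 1)) (.eq (.var 0) (.var 1)))) (by simp [basicAxioms]) x y

theorem zero_add' (x : 𝔄.M) : 0 + x = x :=
  def_induction (fun x => 0 + x = x) (add_zero' 0) (fun x h => by rw [add_succ, h]) x

theorem succ_add (x y : 𝔄.M) : x + 1 + y = x + y + 1 :=
  def_induction (fun y => x + 1 + y = x + y + 1) (by rw [add_zero', add_zero'])
    (fun y h => by rw [add_succ, h, add_succ]) y

theorem add_comm' (x y : 𝔄.M) : x + y = y + x :=
  def_induction (fun y => x + y = y + x) (by rw [add_zero', zero_add'])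
    (fun y h => by rw [add_succ, h, succ_add]) y

theorem add_assoc' (x y z : 𝔄.M) : x + y + z = x + (y + z) :=
  def_induction (fun z => x + y + z = x + (y + z)) (by rw [add_zero', add_zero'])
    (fun z h => by rw [add_succ, h, add_succ, add_succ]) z

instance : AddCommMonoid 𝔄.M where
  add_assoc := add_assoc'
  zero_add := zero_add'
  add_zero := add_zero'
  add_comm := add_comm'
  nsmul := nsmulRec

theorem zero_mul' (x : 𝔄.M) : 0 * x = 0 :=
  def_induction (fun x => 0 * x = 0) (mul_zero' 0) (fun x h => by rw [mul_succ, h, add_zero']) x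

theorem succ_mul (x y : 𝔄.M) : (x + 1) * y = x * y + y :=
  def_induction (fun y => (x + 1) * y = x * y + y) (by simp only [mul_zero', add_zero'])
    (fun y h => by rw [mul_succ, h, mul_succ]; abel) y

theorem mul_comm' (x y : 𝔄.M) : x * y = y * x :=
  def_induction (fun y => x * y = y * x) (by rw [mul_zero', zero_mul'])
    (fun y h => by rw [mul_succ, h, succ_mul]) y

theorem mul_add' (x y z : 𝔄.M) : x * (y + z) = x * y + x * z :=
  def_induction (fun z => x * (y + z) = x * y + x * z) (by simp only [mul_zero', add_zero'])
    (fun z h => by rw [add_succ, mul_succ, h, mul_succ, add_assoc]) z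

theorem mul_assoc' (x y z : 𝔄.M) : x * y * z = x * (y * z) :=
  def_induction (fun z => x * y * z = x * (y * z)) (by simp only [mul_zero'])
    (fun z h => by rw [mul_succ, h, mul_succ, mul_add']) z

theorem mul_one' (x : 𝔄.M) : x * 1 = x := by
  have := mul_succ x 0
  rwa [zero_add, mul_zero', zero_add] at this

instance : CommSemiring 𝔄.M where
  left_distrib := mul_add'
  right_distrib x y z := by rw [mul_comm', mul_add', mul_comm' z, mul_comm' z]
  zero_mul := zero_mul'
  mul_zero := mul_zero'
  mul_assoc := mul_assoc'
  one_mul x := by rw [mul_comm', mul_one']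
  mul_one := mul_one'
  mul_comm := mul_comm'

theorem add_right_cancel' (x y z : 𝔄.M) : x + z = y + z → x = y :=
  def_induction (fun z => x + z = y + z → x = y) (by simp)
    (fun z h hz => h (succ_inj (by rwa [add_assoc, add_assoc]))) z

theorem eq_zero_or_succ (x : 𝔄.M) : x = 0 ∨ ∃ y, x = y + 1 := by
  obtain ⟨y, h⟩ := sigma_induction (fun x y : 𝔄.M => x = 0 ∨ x = y + 1) ⟨0, .inl rfl⟩
    (fun x _ _ => ⟨x, .inr rfl⟩) x
  exact h.imp_right fun h => ⟨y, h⟩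

theorem lt_add_succ (x y : 𝔄.M) : x < x + (y + 1) :=
  def_induction (fun y => x < x + (y + 1)) (by rw [zero_add, lt_succ]; exact .inr rfl)
    (fun y h => by rw [add_succ, lt_succ]; exact .inl h) y

theorem lt_iff_exists_add_succ (x y : 𝔄.M) : x < y ↔ ∃ z, y = x + (z + 1) := by
  refine ⟨fun h => ?_, by rintro ⟨z, rfl⟩; exact lt_add_succ x z⟩
  -- The witness is pulled out of the implication to obtain a `Σ⁰₁` induction formula; when `x < y`
  -- fails its value is irrelevant.
  obtain ⟨z, hz⟩ := sigma_induction (fun y z : 𝔄.M => x < y → y = x + (z + 1))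
    ⟨0, fun h => absurd h (not_lt_zero' x)⟩ (fun y z h => by
      by_cases hx : x < y
      · exact ⟨z + 1, fun _ => by rw [h hx]; ring⟩
      · refine ⟨0, fun h' => ?_⟩
        rcases (lt_succ x y).1 h' with h' | rfl
        · exact absurd h' hx
        · ring) y
  exact ⟨z, hz h⟩

theorem lt_irrefl' (x : 𝔄.M) : ¬ x < x := fun h => by
  obtain ⟨z, hz⟩ := (lt_iff_exists_add_succ x x).1 h
  refine succ_ne_zero z (add_right_cancel' _ _ x ?_)
  rw [zero_add, add_comm, ← hz]

theorem lt_trans' {x y z : 𝔄.M} (h : x < y) (h' : y < z) : x < z := by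
  obtain ⟨a, rfl⟩ := (lt_iff_exists_add_succ x y).1 h
  obtain ⟨b, rfl⟩ := (lt_iff_exists_add_succ _ z).1 h'
  exact (lt_iff_exists_add_succ _ _).2 ⟨a + 1 + b, by ring⟩

theorem lt_trichotomy' (x y : 𝔄.M) : x < y ∨ x = y ∨ y < x :=
  def_induction (fun x => x < y ∨ x = y ∨ y < x) (by
    rcases eq_zero_or_succ y with rfl | ⟨z, rfl⟩
    · exact .inr (.inl rfl)
    · exact .inl ((lt_iff_exists_add_succ _ _).2 ⟨z, by ring⟩))
    (fun x h => by
      rcases h with h | rfl | h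
      · obtain ⟨z, rfl⟩ := (lt_iff_exists_add_succ _ _).1 h
        rcases eq_zero_or_succ z with rfl | ⟨w, rfl⟩
        · exact .inr (.inl (by ring))
        · exact .inl ((lt_iff_exists_add_succ _ _).2 ⟨w, by ring⟩)
      · exact .inr (.inr ((lt_succ _ _).2 (.inr rfl)))
      · exact .inr (.inr ((lt_succ _ _).2 (.inl h)))) x

noncomputable instance : LinearOrder 𝔄.M where
  le x y := x < y ∨ x = y
  le_refl x := .inr rfl
  le_trans x y z := by
    rintro (h | rfl) (h' | rfl)
    · exact .inl (lt_trans' h h')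
    · exact .inl h
    · exact .inl h'
    · exact .inr rfl
  lt_iff_le_not_ge x y := by
    constructor
    · intro h
      refine ⟨.inl h, ?_⟩
      rintro (h' | rfl)
      · exact lt_irrefl' _ (lt_trans' h h')
      · exact lt_irrefl' _ h
    · rintro ⟨h | rfl, h'⟩
      · exact h
      · exact absurd (.inr rfl) h'
  le_antisymm x y := by
    rintro (h | rfl) (h' | h')
    · exact absurd (lt_trans' h h') (lt_irrefl' _)
    · exact h'.symm
    all_goals rfl
  le_total x y := by
    rcases lt_trichotomy' x y with h | rfl | h
    · exact .inl (.inl h)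
    · exact .inl (.inr rfl)
    · exact .inr (.inl h)
  toDecidableLE := Classical.decRel _

theorem le_iff_lt_or_eq' {x y : 𝔄.M} : x ≤ y ↔ x < y ∨ x = y := Iff.rfl

theorem le_iff_exists_add' (x y : 𝔄.M) : x ≤ y ↔ ∃ z, y = x + z := by
  rw [le_iff_lt_or_eq', lt_iff_exists_add_succ]
  constructor
  · rintro (⟨z, rfl⟩ | rfl)
    · exact ⟨z + 1, rfl⟩
    · exact ⟨0, by simp⟩
  · rintro ⟨z, rfl⟩
    rcases eq_zero_or_succ z with rfl | ⟨w, rfl⟩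
    · simp
    · exact .inl ⟨w, rfl⟩

instance : CanonicallyOrderedAdd 𝔄.M where
  exists_add_of_le {x y} h := (le_iff_exists_add' x y).1 h
  le_add_self _ y := (le_iff_exists_add' _ _).2 ⟨y, add_comm _ _⟩
  le_self_add _ y := (le_iff_exists_add' _ _).2 ⟨y, rfl⟩

theorem lt_succ_iff {x y : 𝔄.M} : x < y + 1 ↔ x ≤ y := lt_succ x y

theorem succ_le_iff {x y : 𝔄.M} : x + 1 ≤ y ↔ x < y := by
  rw [le_iff_exists_add', lt_iff_exists_add_succ]
  exact exists_congr fun z => by rw [show x + 1 + z = x + (z + 1) by ring]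

instance : IsStrictOrderedRing 𝔄.M where
  add_le_add_left x y h z := by
    obtain ⟨w, rfl⟩ := (le_iff_exists_add' _ _).1 h
    exact (le_iff_exists_add' _ _).2 ⟨w, by ring⟩
  le_of_add_le_add_left x y z h := by
    obtain ⟨w, hw⟩ := (le_iff_exists_add' _ _).1 h
    exact (le_iff_exists_add' _ _).2 ⟨w, add_right_cancel' _ _ x (by rw [add_comm, hw]; ring)⟩
  zero_le_one := (le_iff_exists_add' _ _).2 ⟨1, (zero_add 1).symm⟩
  exists_pair_ne := ⟨0, 1, fun h => succ_ne_zero (0 : 𝔄.M) (by rw [zero_add, ← h])⟩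
  mul_lt_mul_of_pos_left x hx y z h := by
    obtain ⟨w, rfl⟩ := (lt_iff_exists_add_succ _ _).1 h
    obtain ⟨v, rfl⟩ := (lt_iff_exists_add_succ _ _).1 hx
    exact (lt_iff_exists_add_succ _ _).2 ⟨v * w + v + w, by ring⟩
  mul_lt_mul_of_pos_right x hx y z h := by
    obtain ⟨w, rfl⟩ := (lt_iff_exists_add_succ _ _).1 h
    obtain ⟨v, rfl⟩ := (lt_iff_exists_add_succ _ _).1 hx
    exact (lt_iff_exists_add_succ _ _).2 ⟨v * w + v + w, by ring⟩

instance Def0.le (s t : (ℕ → 𝔄.M) → 𝔄.M) [DefTm s] [DefTm t] :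
    Def0 (fun e => s e ≤ t e) :=
  (inferInstance : Def0 fun e => s e < t e ∨ s e = t e)

instance Def0.ball_le (t : (ℕ → 𝔄.M) → 𝔄.M) (P : 𝔄.M → (ℕ → 𝔄.M) → Prop) [DefTm t]
    [Def0 fun e => P (e 0) fun n => e (n + 1)] : Def0 (fun e => ∀ x, x ≤ t e → P x e) :=
  (inferInstance : Def0 fun e => ∀ x, x < t e + 1 → P x e).congr fun e => by
    simp only [lt_succ_iff]

instance Def0.bex_le (t : (ℕ → 𝔄.M) → 𝔄.M) (P : 𝔄.M → (ℕ → 𝔄.M) → Prop) [DefTm t]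
    [Def0 fun e => P (e 0) fun n => e (n + 1)] : Def0 (fun e => ∃ x, x ≤ t e ∧ P x e) :=
  (inferInstance : Def0 fun e => ∃ x, x < t e + 1 ∧ P x e).congr fun e => by
    simp only [lt_succ_iff]

/-- The least number principle. -/
theorem exists_least (P : 𝔄.M → Prop) [Def0 fun e => P (e 0)] {x : 𝔄.M} (hx : P x) :
    ∃ y, P y ∧ ∀ z, z < y → ¬ P z := by
  by_contra! h
  have key (x : 𝔄.M) : ∀ z, z < x → ¬ P z :=
    def_induction (fun x => ∀ z, z < x → ¬ P z) (fun z hz => absurd hz (not_lt_zero' z))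
      (fun x hx z hz hPz => by
        obtain ⟨w, hw, hPw⟩ := h z hPz
        exact hx w (hw.trans_le (lt_succ_iff.1 hz)) hPw) x
  exact key (x + 1) x (lt_succ_iff.2 le_rfl) hx

end Arithmetic
end Model
end SOA

/-! ### Pairs and codes of finite sets -/

namespace SOA
variable {𝔄 : Str}

theorem DefTm.tail (t : (ℕ → 𝔄.M) → 𝔄.M) [ht : DefTm t] :
    DefTm (fun e => t fun n => e (n + 1)) := by
  obtain ⟨s, v, h⟩ := ht.out
  refine ⟨s, fun n => (v n).map Nat.succ id, fun e => ?_⟩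
  rw [← h]
  congr 1
  funext n
  simp only [assign]
  rcases v n with k | a <;> rfl

/-- The pairing function. -/
abbrev pr (i j : 𝔄.M) : 𝔄.M := (i + j) * (i + j) + i

@[simp] theorem Tm.eval_pair (e : ℕ → 𝔄.M) (s t : Tm) :
    (Tm.pair s t).eval 𝔄 e = pr (s.eval 𝔄 e) (t.eval 𝔄 e) := rfl

variable [h𝔄 : 𝔄.RCA]

/-- The quotient can be bounded by the dividend: this is automatic for a nonzero divisor, and for
divisor `0` the quotient `0` will do. -/
instance Def0.dvd (s t : (ℕ → 𝔄.M) → 𝔄.M) [DefTm s] [DefTm t] :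
    Def0 (fun e => s e ∣ t e) := by
  have := DefTm.tail s
  have := DefTm.tail t
  refine (inferInstance : Def0 fun e => ∃ c, c ≤ t e ∧ t e = s e * c).congr fun e =>
    ⟨fun ⟨c, _, h⟩ => ⟨c, h⟩, fun ⟨c, h⟩ => ?_⟩
  rcases eq_zero_or_succ (s e) with h0 | ⟨d, hd⟩
  · exact ⟨0, zero_le, by rw [h, h0]; ring⟩
  · refine ⟨c, ?_, h⟩
    rw [h, hd, add_mul, one_mul]
    exact le_add_self

theorem le_mul_self' (x : 𝔄.M) : x ≤ x * x := by
  rcases eq_zero_or_succ x with rfl | ⟨y, rfl⟩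
  · simp
  · rw [add_mul (y) 1 (y + 1), one_mul]; exact le_add_self

theorem left_le_pr (i j : 𝔄.M) : i ≤ pr i j := le_add_self

theorem right_le_pr (i j : 𝔄.M) : j ≤ pr i j :=
  (le_add_self.trans (le_mul_self' (i + j))).trans le_self_add

/-- A pair lies between the square of its sum and the next square, so it determines the sum. -/
theorem add_le_add_of_pr_le {i j i' j' : 𝔄.M} (h : pr i j ≤ pr i' j') : i + j ≤ i' + j' := by
  by_contra! hlt
  obtain ⟨z, hz⟩ := (lt_iff_exists_add_succ _ _).1 hlt
  have h₁ : pr i j = pr i' j' +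
      (j' + (i' + j') + 2 * (i' + j') * z + z * z + 2 * z + i + 1) := by
    rw [pr, hz]; ring
  exact (h₁ ▸ h).not_gt (lt_add_succ _ _)

theorem pr_inj {i j i' j' : 𝔄.M} (h : pr i j = pr i' j') : i = i' ∧ j = j' := by
  have h₁ : i + j = i' + j' := le_antisymm (add_le_add_of_pr_le h.le) (add_le_add_of_pr_le h.ge)
  have h₂ : i = i' := by
    simp only [pr, h₁] at h
    exact add_left_cancel h
  subst h₂
  exact ⟨rfl, add_left_cancel h₁⟩

/-! ### Gödel's coding of finite sets by divisibility. -/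

theorem dvd_of_dvd_add {a x y : 𝔄.M} (h : a ∣ x + y) (hx : a ∣ x) : a ∣ y := by
  obtain ⟨c, hc⟩ := h
  obtain ⟨d, rfl⟩ := hx
  rcases le_total c d with h | h
  · have : a * c ≤ a * d := mul_le_mul_right h a
    rw [← hc] at this
    have : y = 0 := le_antisymm ((add_le_iff_nonpos_right _).1 this) zero_le
    exact this ▸ dvd_zero a
  · obtain ⟨z, rfl⟩ := (le_iff_exists_add' _ _).1 h
    exact ⟨z, by grind⟩

/-- Write `p_i = m(i+1) + 1`. Then `(j+1)p_i - (i+1)p_j = j - i`; if `m = |j - i|q`, multiplying by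
`q(i+1)` yields `±(p_i - 1)`, so `p_i` and `p_j` are coprime. The two cases are this Bézout
identity, times `n`, written without subtraction. -/
theorem dvd_of_dvd_mul_of_ne {m i j n : 𝔄.M} (hij : i ≠ j)
    (h₁ : ∀ d, i + (d + 1) = j → d + 1 ∣ m) (h₂ : ∀ d, j + (d + 1) = i → d + 1 ∣ m)
    (h : m * (i + 1) + 1 ∣ n * (m * (j + 1) + 1)) : m * (i + 1) + 1 ∣ n := by
  rcases hij.lt_or_gt with hlt | hlt
  · obtain ⟨d, rfl⟩ := (lt_iff_exists_add_succ _ _).1 hlt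
    obtain ⟨q, rfl⟩ := h₁ d rfl
    refine dvd_of_dvd_add (x := ((d + 1) * q * (i + 1) + 1) *
      ((i + 1) * (i + (d + 1) + 1) * q * n)) ?_ (dvd_mul_right _ _)
    convert dvd_add (h.mul_left ((i + 1) * (i + 1) * q)) (dvd_mul_right _ n) using 1
    ring
  · obtain ⟨d, rfl⟩ := (lt_iff_exists_add_succ _ _).1 hlt
    obtain ⟨q, rfl⟩ := h₂ d rfl
    refine dvd_of_dvd_add (x := (j + (d + 1) + 1) * (j + (d + 1) + 1) * q *
      (n * ((d + 1) * q * (j + 1) + 1))) ?_ (h.mul_left _)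
    refine ⟨((j + (d + 1) + 1) * (j + 1) * q + 1) * n, ?_⟩
    ring

/-- A substitute for the factorial, which would need a recursion not yet available. -/
theorem exists_common_multiple (w : 𝔄.M) : ∃ m, 0 < m ∧ ∀ i, i < w → i + 1 ∣ m :=
  sigma_induction (fun w m : 𝔄.M => 0 < m ∧ ∀ i, i < w → i + 1 ∣ m)
    ⟨1, zero_lt_one, fun i hi => absurd hi (not_lt_zero' i)⟩
    (fun w m ⟨h0, h⟩ => ⟨m * (w + 1), by positivity, fun i hi => by
      rcases (lt_succ _ _).1 hi with hi | rfl
      · exact (h i hi).mul_right _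
      · exact dvd_mul_left _ _⟩) w

/-- `x` belongs to the finite set coded by `a`, `b`, `w`. -/
abbrev InCode (a b w x : 𝔄.M) : Prop := x < w ∧ a * (x + 1) + 1 ∣ b

/-- The number `b` is the product of the pairwise coprime `m(i+1) + 1` over `i < w` in `X`, built up
by `Σ⁰₁` induction. Thus quantifying over finite sets reduces to quantifying over numbers. -/
theorem exists_code (X : 𝔄.S) (w : 𝔄.M) : ∃ a b : 𝔄.M, ∀ x, InCode a b w x ↔ x < w ∧ x ∈ X := by
  obtain ⟨m, hm, hdvd⟩ := exists_common_multiple w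
  have key : ∀ k : 𝔄.M, ∃ b, ∀ i, i < w → (m * (i + 1) + 1 ∣ b ↔ i < k ∧ i ∈ X) := by
    refine sigma_induction (fun k b : 𝔄.M => ∀ i, i < w → (m * (i + 1) + 1 ∣ b ↔ i < k ∧ i ∈ X))
      ⟨1, fun i hi => iff_of_false ?_ fun h => not_lt_zero' i h.1⟩ fun k b hb => ?_
    · rintro ⟨c, hc⟩
      obtain ⟨m', rfl⟩ := (eq_zero_or_succ m).resolve_left hm.ne'
      rcases eq_zero_or_succ c with rfl | ⟨c', rfl⟩
      · simp at hc
      · refine lt_irrefl (1 : 𝔄.M) ((lt_add_succ 1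
          ((m' * i + m' + i) * c' + (m' * i + m' + i) + 2 * c')).trans_eq (Eq.trans ?_ hc.symm))
        ring
    by_cases hk : k ∈ X ∧ k < w
    · refine ⟨b * (m * (k + 1) + 1), fun i hi => ?_⟩
      by_cases hik : i = k
      · subst hik
        exact iff_of_true (dvd_mul_left _ _) ⟨lt_succ_iff.2 le_rfl, hk.1⟩
      · rw [lt_succ, or_iff_left hik, ← hb i hi]
        refine ⟨dvd_of_dvd_mul_of_ne hik (fun d hd => hdvd d ?_) (fun d hd => hdvd d ?_),
          fun h => h.mul_right _⟩
        · refine lt_of_lt_of_le (lt_succ_iff.2 le_rfl) ((le_add_self (b := i)).trans ?_)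
          rw [hd]; exact hk.2.le
        · refine lt_of_lt_of_le (lt_succ_iff.2 le_rfl) ((le_add_self (b := k)).trans ?_)
          rw [hd]; exact hi.le
    · refine ⟨b, fun i hi => ?_⟩
      rw [hb i hi, lt_succ]
      constructor
      · exact fun h => ⟨.inl h.1, h.2⟩
      · rintro ⟨h | rfl, h'⟩
        · exact ⟨h, h'⟩
        · exact absurd ⟨h', hi⟩ hk
  obtain ⟨b, hb⟩ := key w
  exact ⟨m, b, fun x => and_congr_right fun hx => by rw [hb x hx, and_iff_right hx]⟩

end SOA

/-! ### Brown's lemma in models of RCA₀ -/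

namespace SOA
variable {𝔄 : Str}

/-- `u` and `v` are consecutive elements of `H`. -/
abbrev Consecutive (H : 𝔄.S) (u v : 𝔄.M) : Prop :=
  -- The redundant bound `z < v` makes the condition visibly `Σ⁰₀`.
  u ∈ H ∧ v ∈ H ∧ u < v ∧ ∀ z, z < v → z ∈ H → ¬ (u < z ∧ z < v)

/-- The gap size of `H` is `d`. -/
def HasGapSize (H : 𝔄.S) (d : 𝔄.M) : Prop :=
  ((∀ u v, u ∈ H ∧ v ∈ H → u = v) ∧ d = 1) ∨
  (¬ (∀ u v, u ∈ H ∧ v ∈ H → u = v) ∧ (∃ u v, Consecutive H u v ∧ v = u + d) ∧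
    ∀ u v, Consecutive H u v → ¬ u + d < v)

/-- `G` is a bijection from `{i | i < k}` onto `H`. -/
def IsEnumeration (G H : 𝔄.S) (k : 𝔄.M) : Prop :=
  (∀ p ∈ G, ∃ i x, p = pr i x ∧ i < k ∧ x ∈ H) ∧ (∀ i, i < k → ∃! x, pr i x ∈ G) ∧
    ∀ x ∈ H, ∃! i, pr i x ∈ G

theorem eval_isEnumeration (e : ℕ → 𝔄.M) (f : ℕ → 𝔄.S) (G H : ℕ) (k : Tm) :
    (isEnumeration G H k).eval 𝔄 e f ↔ IsEnumeration (f G) (f H) (k.eval 𝔄 e) := by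
  simp [isEnumeration, IsEnumeration]

theorem eval_hasCard (e : ℕ → 𝔄.M) (f : ℕ → 𝔄.S) (H : ℕ) (k : Tm) :
    (hasCard H k).eval 𝔄 e f ↔ ∃ G, IsEnumeration G (f H) (k.eval 𝔄 e) := by
  simp [hasCard, eval_isEnumeration]

theorem eval_consecutive (e : ℕ → 𝔄.M) (f : ℕ → 𝔄.S) (H : ℕ) (x y : Tm) :
    (consecutive H x y).eval 𝔄 e f ↔ Consecutive (f H) (x.eval 𝔄 e) (y.eval 𝔄 e) := by
  simp only [consecutive, Consecutive, Fml.eval_and, Fml.eval_mem, Fml.eval_lt, Fml.eval_all,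
    Fml.eval_imp, Fml.eval_neg, Tm.eval_shift, Tm.eval_var, scons_zero]
  refine and_congr_right fun _ => and_congr_right fun _ => and_congr_right fun _ => ?_
  exact ⟨fun h z _ => h z, fun h z hz h' => h z h'.2 hz h'⟩

theorem eval_hasGapSize (e : ℕ → 𝔄.M) (f : ℕ → 𝔄.S) (H : ℕ) (d : Tm) :
    (hasGapSize H d).eval 𝔄 e f ↔ HasGapSize (f H) (d.eval 𝔄 e) := by
  simp only [hasGapSize, atMostOne, HasGapSize, Fml.eval_and, Fml.eval_or, Fml.eval_neg,
    Fml.eval_all, Fml.eval_ex, Fml.eval_imp, Fml.eval_eq, Fml.eval_mem, Fml.eval_lt,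
    eval_consecutive, Tm.eval_add, Tm.eval_one, Tm.eval_shift, Tm.eval_var, scons_zero, scons_succ]

/-! ### The sequence of block lengths. -/

variable [h𝔄 : 𝔄.RCA]

theorem exists_bound_values {F : 𝔄.S} (hF : ∀ x, ∃ y, pr x y ∈ F) (m : 𝔄.M) :
    ∃ B, ∀ d, d ≤ m → ∃ z, z ≤ B ∧ pr d z ∈ F := by
  refine sigma_induction (fun m B : 𝔄.M => ∀ d, d ≤ m → ∃ z, z ≤ B ∧ pr d z ∈ F)
    ?_ (fun m B h => ?_) m
  · obtain ⟨y, hy⟩ := hF 0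
    exact ⟨y, fun d hd => ⟨y, le_rfl, by rwa [le_antisymm hd zero_le]⟩⟩
  · obtain ⟨y, hy⟩ := hF (m + 1)
    refine ⟨B + y, fun d hd => ?_⟩
    rcases hd with hd | rfl
    · obtain ⟨z, hz, h⟩ := h d (lt_succ_iff.1 hd)
      exact ⟨z, hz.trans le_self_add, h⟩
    · exact ⟨y, le_add_self, hy⟩

/-- `y = x(B + 1)` for a bound `B` of the function `F` on the numbers up to `2x`. -/
abbrev BrownStep (F : 𝔄.S) (x y : 𝔄.M) : Prop :=
  -- For positive `x` the bound `B ≤ y` follows from the equation; it keeps the quantifier bounded.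
  ∃ B, B ≤ y ∧ y = x * (B + 1) ∧ ∀ d, d ≤ x + x → ∃ z, z ≤ B ∧ pr d z ∈ F

/-- The elements of `X` are pairs `(i, y)` justified by a computation of length `i`. -/
def IsChain (F : 𝔄.S) (X : 𝔄.M → Prop) : Prop :=
  ∀ i y, X (pr i y) → 0 < y ∧ (i = 0 ∨ ∃ j x, i = j + 1 ∧ X (pr j x) ∧ BrownStep F x y)

/-- Both components of a pair are at most the pair, hence below `w`; so for coded sets being a chain
is `Σ⁰₀`. -/
theorem isChain_inCode (F : 𝔄.S) (a b w : 𝔄.M) : IsChain F (InCode a b w) ↔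
    ∀ i, i < w → ∀ y, y < w → InCode a b w (pr i y) → 0 < y ∧
      (i = 0 ∨ ∃ j, j < w ∧ ∃ x, x < w ∧ i = j + 1 ∧ InCode a b w (pr j x) ∧
        BrownStep F x y) := by
  constructor
  · intro h i _ y _ hX
    refine ⟨(h i y hX).1, (h i y hX).2.imp_right ?_⟩
    rintro ⟨j, x, hij, hj, hs⟩
    exact ⟨j, (left_le_pr j x).trans_lt hj.1, x, (right_le_pr j x).trans_lt hj.1, hij, hj, hs⟩
  · intro h i y hX
    have := h i ((left_le_pr i y).trans_lt hX.1) y ((right_le_pr i y).trans_lt hX.1) hX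
    refine ⟨this.1, this.2.imp_right ?_⟩
    rintro ⟨j, _, x, _, h⟩
    exact ⟨j, x, h⟩

theorem IsChain.insert {F : 𝔄.S} {X : 𝔄.M → Prop} (hX : IsChain F X) {k n y : 𝔄.M}
    (hk : X (pr k n)) (hy : 0 < y) (h : BrownStep F n y) :
    IsChain F (fun p => X p ∨ p = pr (k + 1) y) := by
  rintro i z (hz | hz)
  · refine ⟨(hX i z hz).1, (hX i z hz).2.imp_right ?_⟩
    rintro ⟨j, x, hij, hj, hs⟩
    exact ⟨j, x, hij, .inl hj, hs⟩
  · obtain ⟨rfl, rfl⟩ := pr_inj hz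
    exact ⟨hy, .inr ⟨k, n, rfl, .inl hk, h⟩⟩

theorem exists_code_insert (a b w p : 𝔄.M) :
    ∃ a' b' w' : 𝔄.M, ∀ x, InCode a' b' w' x ↔ InCode a b w x ∨ x = p := by
  obtain ⟨X, hX⟩ := def_comprehension (fun x => InCode a b w x ∨ x = p)
  obtain ⟨a', b', h⟩ := exists_code X (w + p + 1)
  refine ⟨a', b', w + p + 1, fun x => ?_⟩
  rw [h, hX, and_iff_right_iff_imp, lt_succ_iff]
  rintro (h | rfl)
  · exact h.1.le.trans le_self_add
  · exact le_add_self

-- Primitive recursion by `Σ⁰₁` induction on the length of a coded computation, starting from the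
-- pair `(0, 1)`. As only one existential witness is allowed, `c` bounds the three code numbers and
-- the value together.
set_option synthInstance.maxSize 1000 in
set_option synthInstance.maxHeartbeats 200000 in
theorem exists_chain {F : 𝔄.S} (hF : ∀ x, ∃ y, pr x y ∈ F) (k : 𝔄.M) :
    ∃ a b w n : 𝔄.M, InCode a b w (pr k n) ∧ IsChain F (InCode a b w) := by
  have key := sigma_induction (fun k c : 𝔄.M => ∃ a, a ≤ c ∧ ∃ b, b ≤ c ∧ ∃ w, w ≤ c ∧
    ∃ n, n ≤ c ∧ InCode a b w (pr k n) ∧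
    ∀ i, i < w → ∀ y, y < w → InCode a b w (pr i y) → 0 < y ∧
      (i = 0 ∨ ∃ j, j < w ∧ ∃ x, x < w ∧ i = j + 1 ∧ InCode a b w (pr j x) ∧
        BrownStep F x y))
  simp only [← isChain_inCode] at key
  have hc {k a b w n : 𝔄.M} (h : InCode a b w (pr k n) ∧ IsChain F (InCode a b w)) :
      ∃ c, ∃ a, a ≤ c ∧ ∃ b, b ≤ c ∧ ∃ w, w ≤ c ∧ ∃ n, n ≤ c ∧
        InCode a b w (pr k n) ∧ IsChain F (InCode a b w) :=
    ⟨a + b + w + n, a, (le_self_add.trans le_self_add).trans le_self_add,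
      b, (le_add_self.trans le_self_add).trans le_self_add, w, le_add_self.trans le_self_add,
      n, le_add_self, h⟩
  refine Exists.elim (key ?_ ?_ k) ?_
  · obtain ⟨X, hX⟩ := def_comprehension (fun x : 𝔄.M => x = pr 0 1)
    obtain ⟨a, b, h⟩ := exists_code X (pr 0 1 + 1)
    refine hc (a := a) (b := b) (w := pr 0 1 + 1) (n := 1) ⟨?_, fun i y hi => ?_⟩
    · rw [h, hX, lt_succ_iff]
      exact ⟨le_rfl, rfl⟩
    · rw [h, hX] at hi
      obtain ⟨rfl, rfl⟩ := pr_inj hi.2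
      exact ⟨zero_lt_one, .inl rfl⟩
  · rintro k c ⟨a, _, b, _, w, _, n, _, hn, hchain⟩
    obtain ⟨B, hB⟩ := exists_bound_values hF (n + n)
    have h0 : 0 < n := (hchain k n hn).1
    have hy : BrownStep F n (n * (B + 1)) := by
      refine ⟨B, ?_, rfl, hB⟩
      obtain ⟨n, rfl⟩ := (eq_zero_or_succ n).resolve_left h0.ne'
      exact (le_iff_exists_add' _ _).2 ⟨n * B + n + 1, by ring⟩
    obtain ⟨a', b', w', h⟩ := exists_code_insert a b w (pr (k + 1) (n * (B + 1)))
    refine hc (a := a') (b := b') (w := w') (n := n * (B + 1)) ⟨(h _).2 (.inr rfl), ?_⟩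
    have := hchain.insert hn (mul_pos h0 (by positivity)) hy
    rwa [show InCode a' b' w' = _ from funext fun x => propext (h x)]
  · rintro c ⟨a, _, b, _, w, _, n, _, h⟩
    exact ⟨a, b, w, n, h⟩

/-! ### Gap sizes and sets meeting many blocks. -/

theorem exists_consecutive {H : 𝔄.S} (h : ¬ ∀ u v, u ∈ H ∧ v ∈ H → u = v) :
    ∃ u v, Consecutive H u v := by
  have : ∃ u v, u ∈ H ∧ v ∈ H ∧ u < v := by
    push Not at h
    obtain ⟨u, v, ⟨hu, hv⟩, hne⟩ := h
    rcases hne.lt_or_gt with h | h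
    · exact ⟨u, v, hu, hv, h⟩
    · exact ⟨v, u, hv, hu, h⟩
  obtain ⟨u, v, hu, hv, huv⟩ := this
  obtain ⟨w, ⟨hw, huw⟩, hmin⟩ := exists_least (fun v => v ∈ H ∧ u < v) ⟨hv, huv⟩
  exact ⟨u, w, hu, hw, huw, fun z hzw hz h => hmin z hzw ⟨hz, h.1⟩⟩

/-- A bounded set has a gap size, which is at most every positive upper bound of its gaps. -/
theorem exists_hasGapSize {H : 𝔄.S} {b D : 𝔄.M} (hb : ∀ x ∈ H, x < b) (hD : 1 ≤ D)
    (hgap : ∀ u v, Consecutive H u v → v ≤ u + D) : ∃ d, d ≤ D ∧ HasGapSize H d := by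
  by_cases h : ∀ u v, u ∈ H ∧ v ∈ H → u = v
  · exact ⟨1, hD, .inl ⟨h, rfl⟩⟩
  obtain ⟨d, hd, hmin⟩ := exists_least
    (fun d : 𝔄.M => ∀ u, u < b → ∀ v, v < b → Consecutive H u v → v ≤ u + d)
    (x := D) (fun u _ v _ => hgap u v)
  have hd' (u v) (huv : Consecutive H u v) : v ≤ u + d :=
    hd u (hb u huv.1) v (hb v huv.2.1) huv
  refine ⟨d, not_lt.1 fun hlt => hmin D hlt fun u _ v _ => hgap u v, .inr ⟨h, ?_, ?_⟩⟩
  -- The least bound on the gaps is attained: it is not `0` because some gap exists, and its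
  -- predecessor is exceeded by some gap.
  · rcases eq_zero_or_succ d with rfl | ⟨d', rfl⟩
    · obtain ⟨u, v, huv⟩ := exists_consecutive h
      have := hd' u v huv
      rw [add_zero] at this
      exact absurd huv.2.2.1 this.not_gt
    · have := hmin d' (lt_succ_iff.2 le_rfl)
      push Not at this
      obtain ⟨u, _, v, _, huv, hlt⟩ := this
      refine ⟨u, v, huv, le_antisymm (hd' u v huv) ?_⟩
      rw [← add_assoc]
      exact succ_le_iff.2 hlt
  · exact fun u v huv => (hd' u v huv).not_gt

/-- A set which meets `B + 1` consecutive blocks of length `m` has a subset with `B + 1` elements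
and gap size at most `2m`. -/
theorem exists_large_of_blocks {Z : 𝔄.S} {s m B : 𝔄.M} (hm : 0 < m)
    (hZ : ∀ i, i ≤ B → ∃ x, s + i * m ≤ x ∧ x < s + i * m + m ∧ x ∈ Z) :
    ∃ H G : 𝔄.S, (∀ x ∈ H, x ∈ Z ∧ x < s + m * (B + 1)) ∧ IsEnumeration G H (B + 1) ∧
      ∃ d, d ≤ m + m ∧ HasGapSize H d := by
  -- Choosing the least point of `Z` in block `i` makes the selection definable, so that `H` and its
  -- enumeration exist by comprehension.
  let A (i x : 𝔄.M) : Prop :=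
    s + i * m ≤ x ∧ x < s + i * m + m ∧ x ∈ Z ∧ ∀ y, y < x → s + i * m ≤ y → y ∉ Z
  have hblock {i j : 𝔄.M} (h : i < j) : s + i * m + m ≤ s + j * m := by
    have := mul_le_mul_left (succ_le_iff.2 h) m
    rw [add_mul, one_mul] at this
    rw [add_assoc]
    exact add_le_add_right this s
  have hlt {i x} (hi : i ≤ B) (hx : A i x) : x < s + m * (B + 1) := by
    have := hblock (lt_succ_iff.2 hi)
    rw [mul_comm m]
    exact hx.2.1.trans_le this
  have hex (i) (hi : i ≤ B) : ∃ x, A i x := by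
    obtain ⟨x, h₁, h₂, h₃⟩ := hZ i hi
    obtain ⟨y, ⟨hy₁, hy₂⟩, hmin⟩ := exists_least (fun x => s + i * m ≤ x ∧ x ∈ Z) ⟨h₁, h₃⟩
    refine ⟨y, hy₁, (not_lt.1 fun h => hmin x h ⟨h₁, h₃⟩).trans_lt h₂, hy₂,
      fun z hz h h' => hmin z hz ⟨h, h'⟩⟩
  have huniq {i x y} (hx : A i x) (hy : A i y) : x = y := by
    rcases lt_trichotomy x y with h | h | h
    · exact absurd hx.2.2.1 (hy.2.2.2 x h hx.1)
    · exact h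
    · exact absurd hy.2.2.1 (hx.2.2.2 y h hy.1)
  have hmono {i j x y} (hx : A i x) (hy : A j y) (h : i < j) : x < y :=
    hx.2.1.trans_le ((hblock h).trans hy.1)
  have hindex {i j x} (hi : A i x) (hj : A j x) : i = j := by
    rcases lt_trichotomy i j with h | h | h
    · exact absurd (hmono hi hj h) (lt_irrefl x)
    · exact h
    · exact absurd (hmono hj hi h) (lt_irrefl x)
  obtain ⟨H, hH⟩ := def_comprehension (fun x => ∃ i, i ≤ B ∧ A i x)
  obtain ⟨G, hG⟩ := def_comprehension
    (fun p => ∃ i, i ≤ B ∧ ∃ x, x < s + m * (B + 1) ∧ p = pr i x ∧ A i x)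
  have hG' (i x) : pr i x ∈ G ↔ i ≤ B ∧ A i x := by
    rw [hG]
    constructor
    · rintro ⟨j, hj, y, hy, h, hA⟩
      obtain ⟨rfl, rfl⟩ := pr_inj h
      exact ⟨hj, hA⟩
    · exact fun ⟨hi, hA⟩ => ⟨i, hi, x, hlt hi hA, rfl, hA⟩
  have hHlt (x) (hx : x ∈ H) : x < s + m * (B + 1) := by
    obtain ⟨i, hi, hA⟩ := (hH x).1 hx
    exact hlt hi hA
  refine ⟨H, G, fun x hx => ⟨?_, hHlt x hx⟩, ⟨?_, fun i hi => ?_, fun x hx => ?_⟩, ?_⟩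
  · obtain ⟨i, hi, hA⟩ := (hH x).1 hx
    exact hA.2.2.1
  · intro p hp
    obtain ⟨i, hi, x, _, rfl, hA⟩ := (hG p).1 hp
    exact ⟨i, x, rfl, lt_succ_iff.2 hi, (hH x).2 ⟨i, hi, hA⟩⟩
  · obtain ⟨x, hx⟩ := hex i (lt_succ_iff.1 hi)
    exact ⟨x, (hG' i x).2 ⟨lt_succ_iff.1 hi, hx⟩, fun y hy => huniq ((hG' i y).1 hy).2 hx⟩
  · obtain ⟨i, hi, hA⟩ := (hH x).1 hx
    exact ⟨i, (hG' i x).2 ⟨hi, hA⟩, fun j hj => hindex ((hG' j x).1 hj).2 hA⟩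
  · refine exists_hasGapSize hHlt ?_ fun u v huv => ?_
    · have := succ_le_iff.2 hm
      rw [zero_add] at this
      exact this.trans le_self_add
    · obtain ⟨hu, hv, hlt, hno⟩ := huv
      obtain ⟨i, hi, hui⟩ := (hH u).1 hu
      obtain ⟨j, hj, hvj⟩ := (hH v).1 hv
      have hij : i < j := by
        rcases lt_trichotomy i j with h | rfl | h
        · exact h
        · exact absurd (huniq hui hvj) hlt.ne
        · exact absurd (hmono hvj hui h) hlt.asymm
      have hi' := (succ_le_iff.2 hij).trans hj
      obtain ⟨x, hx⟩ := hex (i + 1) hi'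
      have hux := hmono hui hx (lt_succ_iff.2 le_rfl)
      -- The point chosen in block `i + 1` lies beyond `u`, so the successor `v` of `u` cannot pass
      -- it; two adjacent blocks span only `2m`.
      have hvx : v ≤ x := not_lt.1 fun h =>
        hno x h ((hH x).2 ⟨i + 1, hi', hx⟩) ⟨hux, h⟩
      refine hvx.trans (hx.2.1.le.trans ?_)
      have := add_le_add_left hui.1 (m + m)
      refine le_trans (le_of_eq ?_) this
      ring

/-- Brown's lemma for a colouring `C` of the numbers below the last value `n` of a chain. -/
theorem exists_large_of_chain {F C : 𝔄.S} {a b w r n : 𝔄.M} (hn : InCode a b w (pr r n))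
    (hchain : IsChain F (InCode a b w))
    (hC : ∀ x, x < n → ∃ c, c < r ∧ pr x c ∈ C) :
    ∃ H : 𝔄.S, (∀ x ∈ H, x < n) ∧ (∃ c, ∀ x ∈ H, pr x c ∈ C) ∧
      ∃ k d z, (∃ G, IsEnumeration G H k) ∧ HasGapSize H d ∧ pr d z ∈ F ∧ z < k := by
  -- A least `k` replaces induction on the number of colours. The bounds by `n` keep the condition
  -- `Σ⁰₀`, and `k = r` satisfies it with the whole interval.
  obtain ⟨k, ⟨N, hN, hk, s, hs, hsN, hcol⟩, hmin⟩ := exists_least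
    (fun k : 𝔄.M => ∃ N, N ≤ n ∧ InCode a b w (pr k N) ∧ ∃ s, s ≤ n ∧ s + N ≤ n ∧
      ∀ x, x < n → s ≤ x → x < s + N → ∃ c, c < k ∧ pr x c ∈ C)
    (x := r) ⟨n, le_rfl, hn, 0, zero_le, by rw [zero_add], fun x hx _ _ => hC x hx⟩
  obtain ⟨hN0, rfl | ⟨j, m, rfl, hj, B, _, rfl, hB⟩⟩ := hchain k N hk
  · have hlt : s < s + N := lt_add_of_pos_right s hN0
    obtain ⟨c, hc, _⟩ := hcol s (hlt.trans_le hsN) le_rfl hlt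
    exact absurd hc (not_lt_zero' c)
  have hm : 0 < m := (hchain j m hj).1
  obtain ⟨Z, hZ⟩ := def_comprehension (fun x => pr x j ∈ C)
  -- A block missing colour `j` would use only colours below `j`, contradicting the minimality of `j
  -- + 1`.
  have hblocks (i) (hi : i ≤ B) : ∃ x, s + i * m ≤ x ∧ x < s + i * m + m ∧ x ∈ Z := by
    by_contra! hno
    have hend : s + i * m + m ≤ s + m * (B + 1) := by
      have := mul_le_mul_right (add_le_add_left hi 1) m
      refine le_trans (le_of_eq ?_) (add_le_add_right this s)
      ring
    refine hmin j (lt_succ_iff.2 le_rfl) ⟨m, ?_, hj, s + i * m, ?_, hend.trans hsN, ?_⟩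
    · exact (le_add_self.trans hend).trans hsN
    · exact (le_self_add.trans hend).trans hsN
    · intro x hxn hx hx'
      obtain ⟨c, hc, hxc⟩ := hcol x hxn (le_self_add.trans hx) (hx'.trans_le hend)
      rcases (lt_succ c j).1 hc with hc | rfl
      · exact ⟨c, hc, hxc⟩
      · exact absurd ((hZ x).2 hxc) (hno x hx hx')
  obtain ⟨H, G, hH, hG, d, hd, hgap⟩ := exists_large_of_blocks hm hblocks
  obtain ⟨z, hz, hdz⟩ := hB d hd
  exact ⟨H, fun x hx => (hH x hx).2.trans_le hsN, ⟨j, fun x hx => (hZ x).1 (hH x hx).1⟩,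
    B + 1, d, z, ⟨G, hG⟩, hgap, hdz, lt_succ_iff.2 hz⟩

theorem eval_finiteBrown (e : ℕ → 𝔄.M) (f : ℕ → 𝔄.S) : finiteBrown.eval 𝔄 e f := by
  simp only [finiteBrown, isFunction, isColoring, isHomogeneous, isLarge, eval_hasCard,
    eval_hasGapSize, Fml.eval_allS, Fml.eval_exS, Fml.eval_all, Fml.eval_ex, Fml.eval_exUnique,
    Fml.eval_imp, Fml.eval_and, Fml.eval_mem, Fml.eval_eq, Fml.eval_lt, Tm.eval_pair,
    Tm.eval_shift, Tm.eval_var, Tm.eval_zero, scons_zero, scons_succ]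
  rintro F ⟨-, hF⟩ r -
  obtain ⟨a, b, w, n, hn, hchain⟩ := exists_chain (fun x => (hF x).exists) r
  refine ⟨n, fun C ⟨hC, hC'⟩ => ?_⟩
  obtain ⟨H, hHn, hHC, k, d, z, h⟩ := exists_large_of_chain (C := C) hn hchain fun x hx => by
    obtain ⟨c, hc⟩ := (hC' x hx).exists
    obtain ⟨x', c', h, -, hc'⟩ := hC _ hc
    obtain ⟨rfl, rfl⟩ := pr_inj h
    exact ⟨c, hc', hc⟩
  exact ⟨H, ⟨hHn, hHC⟩, k, d, z, h⟩

theorem provable_finiteBrown : Provable RCA0 finiteBrown :=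
  provable_of_models RCA0_substClosed _ fun 𝔄 h𝔄 e f =>
    have : 𝔄.RCA := ⟨h𝔄, ⟨f 0⟩⟩
    eval_finiteBrown e f

end SOA

/-! ### Brown's lemma for the natural numbers -/

theorem gapSize_image_le {h : ℕ → ℕ} {s m k : ℕ} (hm : 0 < m)
    (hh : ∀ i < k, s + i * m ≤ h i ∧ h i < s + i * m + m) :
    gapSize ((Finset.range k).image h) ≤ 2 * m := by
  have hmono {i j : ℕ} (hij : i < j) (hj : j < k) : h i < h j := by
    have h₁ := (hh i (hij.trans hj)).2
    have h₂ := (hh j hj).1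
    have h₃ : (i + 1) * m ≤ j * m := Nat.mul_le_mul_right m hij
    rw [add_mul, one_mul] at h₃
    omega
  unfold gapSize
  split_ifs
  · omega
  refine Finset.sup_le ?_
  rintro ⟨u, v⟩ huv
  simp only [Finset.mem_filter, Finset.mem_product, Finset.mem_image, Finset.mem_range] at huv
  obtain ⟨⟨⟨i, hi, rfl⟩, ⟨j, hj, rfl⟩⟩, hlt, hno⟩ := huv
  have hij : i < j := by
    rcases lt_trichotomy i j with h' | rfl | h'
    · exact h'
    · exact absurd hlt (lt_irrefl _)
    · exact absurd (hmono h' hi) hlt.asymm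
  have h₁ := hmono (Nat.lt_succ_self i) (by omega)
  have h₂ := hno (h (i + 1)) ⟨i + 1, by omega, rfl⟩
  have h₃ := (hh (i + 1) (by omega)).2
  have h₄ := (hh i hi).1
  rw [add_mul, one_mul] at h₃
  simp only [Nat.succ_eq_add_one] at h₁
  omega

/-- The interval may start at any `s`, because the induction hypothesis is applied to an inner block
that omits the last colour. -/
theorem exists_large_homogeneous (f : ℕ → ℕ) (r : ℕ) : ∃ N, 0 < N ∧ ∀ (C : ℕ → ℕ) (s : ℕ),
    (∀ x, s ≤ x → x < s + N → C x < r) → ∃ H : Finset ℕ,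
      (∀ x ∈ H, s ≤ x ∧ x < s + N) ∧ (∃ c, ∀ x ∈ H, C x = c) ∧ f (gapSize H) < H.card := by
  induction r with
  | zero => exact ⟨1, one_pos, fun C s h => absurd (h s le_rfl (by omega)) (Nat.not_lt_zero _)⟩
  | succ r ih =>
    obtain ⟨m, hm, ih⟩ := ih
    let B := (Finset.range (2 * m + 1)).sup f
    refine ⟨m * (B + 1), by positivity, fun C s hC => ?_⟩
    have hend {i : ℕ} (hi : i < B + 1) : s + i * m + m ≤ s + m * (B + 1) := by
      have := Nat.mul_le_mul_right m hi
      rw [Nat.succ_eq_add_one, add_mul, one_mul] at this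
      rw [mul_comm m]
      omega
    by_cases hblock : ∀ i < B + 1, ∃ x, s + i * m ≤ x ∧ x < s + i * m + m ∧ C x = r
    · choose! h h₁ h₂ h₃ using hblock
      have hinj : Set.InjOn h (Finset.range (B + 1)) := by
        have key {i j : ℕ} (hi : i < B + 1) (hj : j < B + 1) (hij : i < j) : h i ≠ h j := by
          have := h₂ i hi
          have := h₁ j hj
          have := Nat.mul_le_mul_right m (Nat.succ_le_of_lt hij)
          rw [Nat.succ_eq_add_one, add_mul, one_mul] at this
          omega
        intro i hi j hj hij
        rw [Finset.mem_coe, Finset.mem_range] at hi hj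
        rcases lt_trichotomy i j with h' | h' | h'
        · exact absurd hij (key hi hj h')
        · exact h'
        · exact absurd hij.symm (key hj hi h')
      refine ⟨(Finset.range (B + 1)).image h, ?_, ⟨r, ?_⟩, ?_⟩
      · simp only [Finset.mem_image, Finset.mem_range]
        rintro _ ⟨i, hi, rfl⟩
        exact ⟨(Nat.le_add_right _ _).trans (h₁ i hi), (h₂ i hi).trans_le (hend hi)⟩
      · simp only [Finset.mem_image, Finset.mem_range]
        rintro _ ⟨i, hi, rfl⟩
        exact h₃ i hi
      · rw [Finset.card_image_of_injOn hinj, Finset.card_range]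
        refine Nat.lt_succ_of_le (Finset.le_sup (f := f) (Finset.mem_range.2 ?_))
        exact Nat.lt_succ_of_le (gapSize_image_le hm fun i hi => ⟨h₁ i hi, h₂ i hi⟩)
    · push Not at hblock
      obtain ⟨i, hi, hno⟩ := hblock
      obtain ⟨H, hH, hc, hf⟩ := ih C (s + i * m) fun x hx hx' =>
        (Nat.lt_succ_iff_lt_or_eq.1 (hC x (by omega) (hx'.trans_le (hend hi)))).resolve_right
          (hno x hx hx')
      exact ⟨H, fun x hx => ⟨by have := (hH x hx).1; omega, (hH x hx).2.trans_le (hend hi)⟩,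
        hc, hf⟩

theorem finiteBrownLemma : FiniteBrownLemma := by
  intro f r _
  obtain ⟨n, _, hn⟩ := exists_large_homogeneous f r
  refine ⟨n, fun C => ?_⟩
  -- The value `0` outside the domain is a dummy: only points below `n` are considered.
  obtain ⟨H, hH, ⟨c, hc⟩, hf⟩ := hn (fun x => if h : x < n then C ⟨x, h⟩ else 0) 0
    fun x _ hx => by
      rw [zero_add] at hx
      simp only [hx, dif_pos, Fin.is_lt]
  have hlt (x) (hx : x ∈ H) : x < n := by simpa using (hH x hx).2
  -- A point of `H` is needed to name its colour as an element of `Fin r`.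
  obtain ⟨y, hy⟩ : H.Nonempty := Finset.card_pos.1 (Nat.zero_lt_of_lt hf)
  refine ⟨H.attachFin hlt, ⟨C ⟨y, hlt y hy⟩, fun x hx => Fin.ext ?_⟩, ?_⟩
  · rw [Finset.mem_attachFin] at hx
    have h₁ := hc x hx
    have h₂ := hc y hy
    simp only [x.2, hlt y hy, dif_pos] at h₁ h₂
    exact h₁.trans h₂.symm
  · rwa [Finset.map_valEmbedding_attachFin, Finset.card_attachFin]

/-- The finite form of Brown's lemma holds and is provable in RCA₀. -/
theorem mainTheorem5 :
    FiniteBrownLemma ∧ SOA.Provable SOA.RCA0 SOA.finiteBrown :=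
  ⟨finiteBrownLemma, SOA.provable_finiteBrown⟩
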